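/- Let $T\ge 1$, $A_k\in\mathbb{R}^{n\times n}$, $B_k\in\mathbb{R}^{n\times m}$ ($0\le k\le T-1$), $\mu_{\mathrm{ref}}\in\mathbb{R}^n$, and let $\Sigma_{\mathrm{ini}},\Sigma_{\mathrm{fin}},\Sigma_{\mathrm{ref}}\in\mathbb{R}^{n\times n}$ and $\Sigma_{\rho_k}\in\mathbb{R}^{m\times m}$ ($0\le k\le T-1$) be symmetric positive definite; put $\rho_k=\mathcal N(0,\Sigma_{\rho_k})$. *Notation.* For a positive semidefinite matrix, $(\cdot)^{1/2}$ is the positive semidefinite square root. Let $\bar B_k:=B_k(\Sigma_{\rho_k}^{-1}+I)^{-1/2}$. For invertible $A_k$ let $\Phi(k,l)=A_{k-1}\cdots A_l$ for $k>l$, $\Phi(k,k)=I$, and $\Phi(k,l)=A_k^{-1}\cdots A_{l-1}^{-1}$ for $k<l$, and for $k_0<k_1$ let $$G_r(k_1,k_0)=\sum_{k=k_0}^{k_1-1}\Phi(k_1,k+1)\bar B_k\bar B_k^\top\Phi(k_1,k+1)^\top,\qquad G_c(k_1,k_0)=\sum_{k=k_0}^{k_1-1}\Phi(k_0,k+1)\bar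 B_k\bar B_k^\top\Phi(k_0,k+1)^\top .$$ With $G:=G_c(T,0)$ let $$S_0=G^{-1/2}\Sigma_{\mathrm{ini}}G^{-1/2},\qquad S_T=G^{-1/2}\Phi(0,T)\Sigma_{\mathrm{fin}}\Phi(0,T)^\top G^{-1/2},$$ $$\mathcal F_{\mp}:=\pm S_0+\tfrac12 I\mp\left(S_0^{1/2}S_TS_0^{1/2}+\tfrac14 I\right)^{1/2}$$ (upper signs for $\mathcal F_-$, lower signs for $\mathcal F_+$). *Assumptions.* Every $A_k$ is invertible; there is $k_r\in\{1,\dots,T\}$ such that $G_r(k,0)$ is invertible for all $k\in\{k_r,\dots,T\}$ and $G_r(T,k)$ is invertible for all $k\in\{0,\dots,k_r-1\}$; $\mathcal F_-$ and $\mathcal F_+$ are invertible; and every $B_k$ has full column rank. *Policy.* Let $Q_0=G^{1/2}S_0^{1/2}\mathcal F_-^{-1}S_0^{1/2}G^{1/2}$ and $Q_{k+1}=A_kQ_kA_k^\top-\bar B_k\bar B_k^\top$, and let $\pi^\rho$ be the Gaussian state-feedback policy $$\pi^\rho_k(\cdot\mid x)=\mathcal N\left(-\Sigma_{\pi^\rho_k}B_k^\top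 Q_{k+1}^{-1}A_kx,\ \Sigma_{\pi^\rho_k}\right),\qquad \Sigma_{\pi^\rho_k}=\left(\Sigma_{\rho_k}^{-1}+I+B_k^\top Q_{k+1}^{-1}B_k\right)^{-1}.$$ *Bridge problem.* Let $\mathbb Q^\rho$ be the law on $(\mathbb R^n)^{T+1}$ of the process $x_0\sim\mathcal N(\mu_{\mathrm{ref}},\Sigma_{\mathrm{ref}})$, $x_{k+1}=A_kx_k+B_kw_k$ with $x_0$ and $w_k\sim\rho_k$ ($0\le k\le T-1$) independent. Consider $$\min_{\mathbb P}\ \mathcal D_{\mathrm{KL}}[\mathbb P\,\|\,\mathbb Q^\rho]+\mathbb E_{\mathbb P}\left[\sum_{k=0}^{T-1}\tfrac12\left\|B_k^\dagger(x_{k+1}-A_kx_k)\right\|^2\right]$$ over all probability measures $\mathbb P$ on $(\mathbb R^n)^{T+1}$ whose marginals at times $0$ and $T$ are $\mathcal N(0,\Sigma_{\mathrm{ini}})$ and $\mathcal N(0,\Sigma_{\mathrm{fin}})$, where $\dagger$ denotes the Moore–Penrose inverse. *Conclusion.* All $Q_k$ ($0\le k\le T$) are invertible and all matrices $\Sigma_{\rho_k}^{-1}+I+B_k^\top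 Q_{k+1}^{-1}B_k$ ($0\le k\le T-1$) are positive definite, so $\pi^\rho$ is well defined; the problem has a unique minimizer and a finite minimum; and the minimizer is $\mathbb P^{\pi^\rho}$, the law of the process $x_0\sim\mathcal N(0,\Sigma_{\mathrm{ini}})$, $x_{k+1}=A_kx_k+B_ku_k$ with $u_k\sim\pi^\rho_k(\cdot\mid x_k)$ for $0\le k\le T-1$. -/

import Mathlib

open MeasureTheory ProbabilityTheory
open scoped ENNReal Matrix MatrixOrder

noncomputable section

namespace MIBridge

/-- The state space `ℝⁿ` with its Euclidean structure. -/
abbrev Vec (n : ℕ) : Type := EuclideanSpace ℝ (Fin n)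

/-- Real matrices of size `n × m`. -/
abbrev Mat (n m : ℕ) : Type := Matrix (Fin n) (Fin m) ℝ

/-! ### Matrix functions -/

/-- The positive semidefinite square root of a positive semidefinite matrix. -/
def msqrt {n : ℕ} (M : Mat n n) : Mat n n := CFC.sqrt M

/-- The Moore-Penrose inverse `M† = (Mᵀ M)† Mᵀ`, where the pseudoinverse of the symmetric matrix
`Mᵀ M` inverts the nonzero eigenvalues and keeps the zero ones (`0⁻¹ = 0` in `ℝ`).
The lemma `penrose` below shows that it satisfies the four Penrose equations. -/
def pinv {n m : ℕ} (M : Mat n m) : Mat m n := cfc (fun t : ℝ => t⁻¹) (Mᵀ * M) * Mᵀ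

/-- The four equations that characterize the Moore-Penrose inverse. -/
theorem penrose {n m : ℕ} (M : Mat n m) :
    M * pinv M * M = M ∧ pinv M * M * pinv M = pinv M ∧
      (M * pinv M)ᵀ = M * pinv M ∧ (pinv M * M)ᵀ = pinv M * M := by
  set G : Mat m m := Mᵀ * M with hG
  have hGs : Gᵀ = G := by simp [hG, Matrix.transpose_mul]
  have hGsa : IsSelfAdjoint G := by
    change star G = G
    rw [Matrix.star_eq_conjTranspose, Matrix.conjTranspose_eq_transpose_of_trivial, hGs]
  have hfin : (spectrum ℝ G).Finite := Matrix.finite_spectrum G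
  have hc : ∀ f : ℝ → ℝ, ContinuousOn f (spectrum ℝ G) := fun f => hfin.continuousOn f
  set H : Mat m m := cfc (fun t : ℝ => t⁻¹) G with hH
  have hHs : Hᵀ = H := by
    have h : IsSelfAdjoint H := cfc_predicate _ G
    have h' : star H = H := h
    rwa [Matrix.star_eq_conjTranspose, Matrix.conjTranspose_eq_transpose_of_trivial] at h'
  have hid : cfc (fun t : ℝ => t) G = G := cfc_id' ℝ G
  have hmul : ∀ f g : ℝ → ℝ, cfc (fun t => f t * g t) G = cfc f G * cfc g G :=
    fun f g => cfc_mul f g G (hc f) (hc g)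
  have hGHG : G * H * G = G := by
    have h := hmul (fun t => t * t⁻¹) (fun t => t)
    rw [hmul (fun t => t) (fun t => t⁻¹), hid, ← hH] at h
    rw [← h]
    simp only [mul_inv_mul_cancel]
    exact hid
  have hHGH : H * G * H = H := by
    have h := hmul (fun t => t⁻¹ * t) (fun t => t⁻¹)
    rw [hmul (fun t => t⁻¹) (fun t => t), hid, ← hH] at h
    rw [← h, hH]
    congr 1
    funext t
    by_cases ht : t = 0
    · simp [ht]
    · field_simp
  have hcomm : H * G = G * H := by
    have h := hmul (fun t => t⁻¹) (fun t => t)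
    simp only [mul_comm (_⁻¹ : ℝ)] at h
    rw [hmul (fun t => t) (fun t => t⁻¹), hid, ← hH] at h
    exact h.symm
  have hp : pinv M = H * Mᵀ := rfl
  refine ⟨?_, ?_, ?_, ?_⟩
  · have hz : (M * H * G - M)ᵀ * (M * H * G - M) = 0 := by
      simp only [Matrix.transpose_sub, Matrix.transpose_mul, hGs, hHs]
      have e : (G * (H * Mᵀ) - Mᵀ) * (M * H * G - M)
          = G * H * (Mᵀ * M) * H * G - G * H * (Mᵀ * M) - (Mᵀ * M) * H * G + Mᵀ * M := by
        simp only [Matrix.sub_mul, Matrix.mul_sub, Matrix.mul_assoc]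
        abel
      rw [e, ← hG, hGHG, hGHG]
      simp
    have h0 : M * H * G - M = 0 := by
      rw [← Matrix.conjTranspose_eq_transpose_of_trivial] at hz
      exact Matrix.conjTranspose_mul_self_eq_zero.1 hz
    rw [hp, ← Matrix.mul_assoc, Matrix.mul_assoc (M * H), ← hG]
    exact sub_eq_zero.1 h0
  · rw [hp, Matrix.mul_assoc H, ← hG, ← Matrix.mul_assoc, hHGH]
  · rw [hp]
    simp only [Matrix.transpose_mul, Matrix.transpose_transpose, hHs, Matrix.mul_assoc]
  · rw [hp, Matrix.mul_assoc, ← hG, Matrix.transpose_mul, hGs, hHs, hcomm]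

/-- The squared weighted seminorm `‖x‖²_M = xᵀ M x`. -/
def sqNorm {n : ℕ} (M : Mat n n) (x : Vec n) : ℝ := x.ofLp ⬝ᵥ (M *ᵥ x.ofLp)

/-! ### State transition matrices and Gramians of the system with matrices `A k` and `B k` -/

/-- `fwd A l d = A_{l+d-1} ⋯ A_l`. -/
def fwd {n : ℕ} (A : ℕ → Mat n n) (l : ℕ) : ℕ → Mat n n
  | 0 => 1
  | d + 1 => A (l + d) * fwd A l d

/-- `bwd A k d = A_k⁻¹ ⋯ A_{k+d-1}⁻¹`. -/
def bwd {n : ℕ} (A : ℕ → Mat n n) (k : ℕ) : ℕ → Mat n n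
  | 0 => 1
  | d + 1 => bwd A k d * (A (k + d))⁻¹

/-- The state transition matrix `Φ(k, l)`. -/
def Phi {n : ℕ} (A : ℕ → Mat n n) (k l : ℕ) : Mat n n :=
  if l ≤ k then fwd A l (k - l) else bwd A k (l - k)

/-- The reachability Gramian `G_r(k₁, k₀)`. -/
def Gr {n m : ℕ} (A : ℕ → Mat n n) (B : ℕ → Mat n m) (k₁ k₀ : ℕ) : Mat n n :=
  ∑ k ∈ Finset.Ico k₀ k₁, Phi A k₁ (k + 1) * B k * (B k)ᵀ * (Phi A k₁ (k + 1))ᵀ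

/-- The controllability Gramian `G_c(k₁, k₀)`. -/
def Gc {n m : ℕ} (A : ℕ → Mat n n) (B : ℕ → Mat n m) (k₁ k₀ : ℕ) : Mat n n :=
  ∑ k ∈ Finset.Ico k₀ k₁, Phi A k₀ (k + 1) * B k * (B k)ᵀ * (Phi A k₀ (k + 1))ᵀ

/-- The normalized initial covariance `S₀`. -/
def S0 {n m : ℕ} (T : ℕ) (A : ℕ → Mat n n) (B : ℕ → Mat n m) (Sini : Mat n n) : Mat n n :=
  (msqrt (Gc A B T 0))⁻¹ * Sini * (msqrt (Gc A B T 0))⁻¹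

/-- The normalized terminal covariance `S_T`. -/
def ST {n m : ℕ} (T : ℕ) (A : ℕ → Mat n n) (B : ℕ → Mat n m) (Sfin : Mat n n) : Mat n n :=
  (msqrt (Gc A B T 0))⁻¹ * Phi A 0 T * Sfin * (Phi A 0 T)ᵀ * (msqrt (Gc A B T 0))⁻¹

/-- The matrix `(S₀^{1/2} S_T S₀^{1/2} + I/4)^{1/2}`. -/
def midRoot {n m : ℕ} (T : ℕ) (A : ℕ → Mat n n) (B : ℕ → Mat n m) (Sini Sfin : Mat n n) :
    Mat n n :=
  msqrt (msqrt (S0 T A B Sini) * ST T A B Sfin * msqrt (S0 T A B Sini)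
    + (1 / 4 : ℝ) • (1 : Mat n n))

/-- The matrix `S₀ + I/2 - (S₀^{1/2} S_T S₀^{1/2} + I/4)^{1/2}`. -/
def Fminus {n m : ℕ} (T : ℕ) (A : ℕ → Mat n n) (B : ℕ → Mat n m) (Sini Sfin : Mat n n) :
    Mat n n :=
  S0 T A B Sini + (1 / 2 : ℝ) • (1 : Mat n n) - midRoot T A B Sini Sfin

/-- The matrix `-S₀ + I/2 + (S₀^{1/2} S_T S₀^{1/2} + I/4)^{1/2}`. -/
def Fplus {n m : ℕ} (T : ℕ) (A : ℕ → Mat n n) (B : ℕ → Mat n m) (Sini Sfin : Mat n n) :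
    Mat n n :=
  -S0 T A B Sini + (1 / 2 : ℝ) • (1 : Mat n n) + midRoot T A B Sini Sfin

/-- The solution `Q_k` of the Lyapunov difference equation
`Q_{k+1} = A_k Q_k A_kᵀ - B_k B_kᵀ` with its prescribed initial value. -/
def lyap {n m : ℕ} (T : ℕ) (A : ℕ → Mat n n) (B : ℕ → Mat n m) (Sini Sfin : Mat n n) :
    ℕ → Mat n n
  | 0 => msqrt (Gc A B T 0) * msqrt (S0 T A B Sini) * (Fminus T A B Sini Sfin)⁻¹
      * msqrt (S0 T A B Sini) * msqrt (Gc A B T 0)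
  | k + 1 => A k * lyap T A B Sini Sfin k * (A k)ᵀ - B k * (B k)ᵀ

/-- The modified input matrix `B_k^ρ = B_k (Σ_{ρ_k}⁻¹ + I)^{-1/2}`. -/
def inputRho {n m : ℕ} (B : ℕ → Mat n m) (Srho : ℕ → Mat m m) (k : ℕ) : Mat n m :=
  B k * (msqrt ((Srho k)⁻¹ + 1))⁻¹

/-! ### Policies -/

/-- Measurability of a Gaussian law in its mean. -/
theorem measurable_gaussian {n m : ℕ} (K : Mat m n) (S : Mat m m) :
    Measurable fun x : Vec n => multivariateGaussian (K.toEuclideanLin x) S := by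
  have hK : Measurable fun x : Vec n => K.toEuclideanLin x :=
    (LinearMap.continuous_of_finiteDimensional _).measurable
  refine Measure.measurable_of_measurable_coe _ fun s hs => ?_
  have hf : Measurable fun p : Vec n × Vec m =>
      K.toEuclideanLin p.1 + Matrix.toEuclideanCLM (𝕜 := ℝ) (CFC.sqrt S) p.2 :=
    (hK.comp measurable_fst).add
      ((Matrix.toEuclideanCLM (𝕜 := ℝ) (CFC.sqrt S)).measurable.comp measurable_snd)
  have h := measurable_measure_prodMk_left (ν := stdGaussian (Vec m)) (hf hs)
  convert h using 1
  funext x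
  rw [multivariateGaussian, Measure.map_apply (by fun_prop) hs]
  rfl

/-- The Gaussian state feedback policy `u ∼ N(K x, S)` given the state `x`. -/
def gaussianPolicy {n m : ℕ} (K : Mat m n) (S : Mat m m) : Kernel (Vec n) (Vec m) where
  toFun x := multivariateGaussian (K.toEuclideanLin x) S
  measurable' := measurable_gaussian K S

/-- The inverse `Σ_{ρ_k}⁻¹ + I + B_kᵀ Q_{k+1}⁻¹ B_k` of the covariance of the policy `π^ρ_k`. -/
def precision {n m : ℕ} (T : ℕ) (A : ℕ → Mat n n) (B : ℕ → Mat n m) (Srho : ℕ → Mat m m)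
    (Sini Sfin : Mat n n) (k : ℕ) : Mat m m :=
  (Srho k)⁻¹ + 1 + (B k)ᵀ * (lyap T A (inputRho B Srho) Sini Sfin (k + 1))⁻¹ * B k

/-- The policy `π^ρ`: given the state `x` at time `k`, the input is Gaussian with covariance
`Σ = (Σ_{ρ_k}⁻¹ + I + B_kᵀ Q_{k+1}⁻¹ B_k)⁻¹` and mean `-Σ B_kᵀ Q_{k+1}⁻¹ A_k x`. -/
def policyRho {n m : ℕ} (T : ℕ) (A : ℕ → Mat n n) (B : ℕ → Mat n m) (Srho : ℕ → Mat m m)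
    (Sini Sfin : Mat n n) (k : ℕ) : Kernel (Vec n) (Vec m) :=
  gaussianPolicy
    (-((precision T A B Srho Sini Sfin k)⁻¹ * (B k)ᵀ
      * (lyap T A (inputRho B Srho) Sini Sfin (k + 1))⁻¹ * A k))
    (precision T A B Srho Sini Sfin k)⁻¹

/-! ### Laws of state processes -/

/-- The transition kernel of `x_{k+1} = A x_k + B u_k`, where `u_k ∼ π(· | x_k)`. -/
def step {n m : ℕ} (A : Mat n n) (B : Mat n m) (π : Kernel (Vec n) (Vec m)) :
    Kernel (Vec n) (Vec n) :=
  (Kernel.id ×ₖ π).map fun p : Vec n × Vec m => A.toEuclideanLin p.1 + B.toEuclideanLin p.2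

/-- The law on `(ℝⁿ)^{T+1}` of the state process `(x_0, …, x_T)` with `x_0 ∼ μ₀`,
`x_{k+1} = A_k x_k + B_k u_k` and, given the past, `u_k ∼ π_k(· | x_k)`. -/
def processLaw {n m : ℕ} (A : ℕ → Mat n n) (B : ℕ → Mat n m) (μ₀ : Measure (Vec n))
    (π : ℕ → Kernel (Vec n) (Vec m)) : (T : ℕ) → Measure (Fin (T + 1) → Vec n)
  | 0 => μ₀.map fun x _ => x
  | T + 1 =>
    (processLaw A B μ₀ π T ⊗ₘ
        (step (A T) (B T) (π T)).comap (fun x : Fin (T + 1) → Vec n => x (Fin.last T))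
          (measurable_pi_apply _)).map
      fun p => (Fin.snoc p.1 p.2 : Fin (T + 2) → Vec n)

/-- The controlled process law `ℙ^π`, started from `N(0, Σ_ini)` and driven by the policy `π`. -/
def controlledLaw {n m : ℕ} (T : ℕ) (A : ℕ → Mat n n) (B : ℕ → Mat n m) (Sini : Mat n n)
    (π : ℕ → Kernel (Vec n) (Vec m)) : Measure (Fin (T + 1) → Vec n) :=
  processLaw A B (multivariateGaussian 0 Sini) π T

/-- The reference process law `ℚ^ρ`: started from `N(μ_ref, Σ_ref)` and driven by independent
noise `w_k ∼ N(0, Σ_{ρ_k})`. -/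
def referenceLaw {n m : ℕ} (T : ℕ) (A : ℕ → Mat n n) (B : ℕ → Mat n m) (Srho : ℕ → Mat m m)
    (μref : Vec n) (Sref : Mat n n) : Measure (Fin (T + 1) → Vec n) :=
  processLaw A B (multivariateGaussian μref Sref)
    (fun k => Kernel.const (Vec n) (multivariateGaussian 0 (Srho k))) T

/-! ### The generalized Schrödinger bridge problem with fixed reference process -/

/-- The probability measures on `(ℝⁿ)^{T+1}` whose marginals at times `0` and `T` are
`N(0, Σ_ini)` and `N(0, Σ_fin)`. -/
def couplings {n : ℕ} (T : ℕ) (Sini Sfin : Mat n n) : Set (Measure (Fin (T + 1) → Vec n)) :=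
  {P | IsProbabilityMeasure P ∧
    P.map (fun x => x 0) = multivariateGaussian 0 Sini ∧
    P.map (fun x => x (Fin.last T)) = multivariateGaussian 0 Sfin}

/-- The potential `V(x_0, …, x_T) = ∑_{k<T} ½ ‖x_{k+1} - A_k x_k‖²` with the weight
`B_k†ᵀ B_k†`. -/
def potential {n m : ℕ} (T : ℕ) (A : ℕ → Mat n n) (B : ℕ → Mat n m)
    (x : Fin (T + 1) → Vec n) : ℝ :=
  ∑ k : Fin T, (1 / 2 : ℝ) * sqNorm ((pinv (B k))ᵀ * pinv (B k))
    (x k.succ - (A k).toEuclideanLin (x k.castSucc))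

/-- The objective `D_KL[P ‖ ℚ^ρ] + 𝔼_P[V]`, in `[0, ∞]`; the potential is nonnegative. -/
def objective {n m : ℕ} (T : ℕ) (A : ℕ → Mat n n) (B : ℕ → Mat n m) (Srho : ℕ → Mat m m)
    (μref : Vec n) (Sref : Mat n n) (P : Measure (Fin (T + 1) → Vec n)) : ℝ≥0∞ :=
  InformationTheory.klDiv P (referenceLaw T A B Srho μref Sref)
    + ∫⁻ x, ENNReal.ofReal (potential T A B x) ∂P

end MIBridge

end

open MIBridge

/-! The proof is a Gibbs variational argument. The closed-loop law has density `exp (f - V)` with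
respect to the reference law, where `V` is the potential and `f` is a function of `x 0` plus a
function of `x T`. For a coupling `P` of finite cost, expanding the logarithm shows that the cost is
the divergence of `P` from the closed loop plus the mean of `f`, and this mean is fixed by the two
prescribed marginals. Hence the closed loop, once known to be feasible, is the only minimizer
(`klDiv_add_le_klDiv_add_potential`).

The density comes from completing a square (`sqNorm_feedback`): the log-density of the policy
relative to the prior is a constant plus `-½|u|² + ½ xᵀ Q_k⁻¹ x - ½ yᵀ Q_{k+1}⁻¹ y`, with `y = A_k x
+ B_k u`. Full column rank turns the first term into the potential, and the other two telescope to
the endpoints.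

The algebra is done in the coordinates of time `0`, where `Q_k` becomes `Q_0 - g_k` with `g_k =
G_c(k, 0)` increasing to `G`. The choice of `Q_0` means `Q_0⁻¹ = G⁻¹ - W` with `W` positive definite
(`exists_initial_split`). If `g_k` is positive definite, then `g_k⁻¹ - Q_0⁻¹ = W + (g_k⁻¹ - G⁻¹)` is
too, so `Q_0 - g_k` is invertible; if `G - g_k` is, the same argument runs backward from time `T`.
The Gramian condition provides one of the two for each `k`. The resulting formulas for `(Q_0 -
g_k)⁻¹`, with a Schur complement, make the precisions positive definite. Finally, closed-loop
covariances keep the form `Q Y Q + Q` (`closedLoop_step`), and the quadratic equation behind `W`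
makes the last one equal to `Sfin`. -/

namespace MIBridge

/-! ### Matrix algebra -/

theorem msqrt_mul_self {n : ℕ} {M : Mat n n} (h : M.PosSemidef) : msqrt M * msqrt M = M :=
  CFC.sqrt_mul_sqrt_self M h.nonneg

theorem msqrt_posSemidef {n : ℕ} (M : Mat n n) : (msqrt M).PosSemidef :=
  Matrix.nonneg_iff_posSemidef.1 (CFC.sqrt_nonneg M)

theorem msqrt_posDef {n : ℕ} {M : Mat n n} (h : M.PosDef) : (msqrt M).PosDef := by
  rw [(msqrt_posSemidef M).posDef_iff_isUnit]
  have h1 : IsUnit (msqrt M * msqrt M) := by rw [msqrt_mul_self h.posSemidef]; exact h.isUnit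
  exact isUnit_of_mul_isUnit_left h1

theorem _root_.Matrix.PosDef.transpose_eq {n : ℕ} {M : Mat n n} (h : M.PosDef) : Mᵀ = M := by
  simpa using h.isHermitian.eq

theorem posDef_conj {n : ℕ} {M : Mat n n} (h : M.PosDef) {U : Mat n n} (hU : IsUnit U) :
    (U * M * Uᵀ).PosDef := by
  have := (Matrix.IsUnit.posDef_star_right_conjugate_iff (x := M) hU).2 h
  simpa [Matrix.star_eq_conjTranspose] using this

theorem posSemidef_conj {n m : ℕ} {M : Mat m m} (h : M.PosSemidef) (U : Mat n m) :
    (U * M * Uᵀ).PosSemidef := by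
  simpa using h.mul_mul_conjTranspose_same U

theorem posDef_conj' {n m : ℕ} {M : Mat n n} (h : M.PosDef) {U : Mat n m}
    (hU : Function.Injective U.mulVec) : (Uᵀ * M * U).PosDef := by
  simpa using h.conjTranspose_mul_mul_same hU

/-- A positive semidefinite matrix whose square exceeds `1/4` exceeds `1/2`. -/
theorem posDef_sub_half {n : ℕ} {M : Mat n n} (hM : M.PosSemidef)
    (h : (M * M - (1 / 4 : ℝ) • (1 : Mat n n)).PosDef) :
    (M - (1 / 2 : ℝ) • (1 : Mat n n)).PosDef := by
  have hH : (M - (1 / 2 : ℝ) • (1 : Mat n n)).IsHermitian := by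
    refine hM.isHermitian.sub ?_
    simp [Matrix.IsHermitian]
  rw [hH.posDef_iff_eigenvalues_pos]
  intro i
  set μ := hH.eigenvalues i
  set v : Fin n → ℝ := (hH.eigenvectorBasis i).ofLp with hv
  have hv0 : v ≠ 0 := by
    intro h0
    have h1 := hH.eigenvectorBasis.orthonormal.ne_zero i
    exact h1 (by ext j; exact congrFun h0 j)
  have hev : (M - (1 / 2 : ℝ) • (1 : Mat n n)) *ᵥ v = μ • v := hH.mulVec_eigenvectorBasis i
  have hMv : M *ᵥ v = (μ + 1 / 2) • v := by
    rw [Matrix.sub_mulVec, Matrix.smul_mulVec, Matrix.one_mulVec] at hev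
    rw [add_smul, ← hev]; abel
  have hvv : 0 < v ⬝ᵥ v := by
    have := Matrix.dotProduct_star_self_pos_iff.2 hv0
    simpa using this
  have h1 := hM.dotProduct_mulVec_nonneg v
  have h2 := h.dotProduct_mulVec_pos hv0
  rw [hMv] at h1
  rw [Matrix.sub_mulVec, ← Matrix.mulVec_mulVec, hMv, Matrix.mulVec_smul, hMv, Matrix.smul_mulVec,
    Matrix.one_mulVec] at h2
  simp only [star_trivial, dotProduct_smul, dotProduct_sub, smul_eq_mul] at h1 h2
  -- The eigenvalue `μ + 1/2` of `M` is nonnegative and its square exceeds `1/4`, which excludes `μ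
  -- ≤ 0`.
  have h3 : 0 ≤ μ + 1 / 2 := nonneg_of_mul_nonneg_left h1 hvv
  by_contra hneg
  push Not at hneg
  nlinarith

theorem isUnit_iff_exists_inv {n : ℕ} {M : Mat n n} (N : Mat n n) (h : M * N = 1) :
    IsUnit M ∧ M⁻¹ = N :=
  ⟨(Matrix.isUnit_iff_isUnit_det _).2 (Matrix.isUnit_det_of_right_inverse h),
    Matrix.inv_eq_right_inv h⟩

theorem mul_inv_of_isUnit {n : ℕ} {M : Mat n n} (h : IsUnit M) : M * M⁻¹ = 1 :=
  Matrix.mul_nonsing_inv _ ((Matrix.isUnit_iff_isUnit_det _).1 h)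

theorem inv_mul_of_isUnit {n : ℕ} {M : Mat n n} (h : IsUnit M) : M⁻¹ * M = 1 :=
  Matrix.nonsing_inv_mul _ ((Matrix.isUnit_iff_isUnit_det _).1 h)

/-- The matrix `W` with `Q₀⁻¹ = G⁻¹ - W`. -/
theorem exists_initial_split {n : ℕ} {G Sini Sf : Mat n n} (hG : G.PosDef) (hi : Sini.PosDef)
    (hf : Sf.PosDef) {S s M : Mat n n}
    (hS : S = (msqrt G)⁻¹ * Sini * (msqrt G)⁻¹) (hs : s = msqrt S)
    (hM : M = msqrt (s * ((msqrt G)⁻¹ * Sf * (msqrt G)⁻¹) * s + (1 / 4 : ℝ) • (1 : Mat n n)))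
    (hF : IsUnit (S + (1 / 2 : ℝ) • (1 : Mat n n) - M)) :
    ∃ W : Mat n n, W.PosDef ∧
      (msqrt G * s * (S + (1 / 2 : ℝ) • (1 : Mat n n) - M)⁻¹ * s * msqrt G) * (G⁻¹ - W) = 1 ∧
      Sf = G * (W * Sini * W + W) * G := by
  set R := msqrt G with hR
  have hRp : R.PosDef := msqrt_posDef hG
  have hRR : R * R = G := msqrt_mul_self hG.posSemidef
  have hr : (R⁻¹)ᵀ = R⁻¹ := hRp.inv.transpose_eq
  have hSp : S.PosDef := by
    have := posDef_conj hi hRp.inv.isUnit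
    rwa [hr, ← hS] at this
  have hsp : s.PosDef := hs ▸ msqrt_posDef hSp
  have hss : s * s = S := hs ▸ msqrt_mul_self hSp.posSemidef
  have hS'p : (R⁻¹ * Sf * R⁻¹).PosDef := by
    have := posDef_conj hf hRp.inv.isUnit
    rwa [hr] at this
  have hPp : (s * (R⁻¹ * Sf * R⁻¹) * s).PosDef := by
    have := posDef_conj hS'p hsp.isUnit
    rwa [hsp.transpose_eq] at this
  set P := s * (R⁻¹ * Sf * R⁻¹) * s with hP
  have hMM : M * M = P + (1 / 4 : ℝ) • (1 : Mat n n) := by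
    rw [hM]
    refine msqrt_mul_self (hPp.posSemidef.add (Matrix.PosSemidef.one.smul (by norm_num)))
  have hN : (M - (1 / 2 : ℝ) • (1 : Mat n n)).PosDef := by
    apply posDef_sub_half (hM ▸ msqrt_posSemidef _)
    rw [hMM]; simpa using hPp
  set N := M - (1 / 2 : ℝ) • (1 : Mat n n) with hNdef
  -- The shift by `1/2` turns `M² = P + 1/4` into this quadratic equation, which becomes the
  -- terminal covariance identity once the scaling is undone.
  have hNN : N * N + N = P := by
    have : P = M * M - (1 / 4 : ℝ) • (1 : Mat n n) := by rw [hMM]; simp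
    rw [this, hNdef]
    simp only [sub_mul, mul_sub, smul_mul_assoc, mul_smul_comm, one_mul, mul_one, smul_sub,
      smul_smul]
    module
  have hF' : S + (1 / 2 : ℝ) • (1 : Mat n n) - M = S - N := by rw [hNdef]; abel
  rw [hF'] at hF ⊢
  have eR := mul_inv_of_isUnit hRp.isUnit
  have eR' := inv_mul_of_isUnit hRp.isUnit
  have eG : G⁻¹ = R⁻¹ * R⁻¹ := by rw [← hRR, Matrix.mul_inv_rev]
  have eS : Sini = R * S * R := by
    rw [hS]; simp only [← mul_assoc, eR, one_mul]; simp only [mul_assoc, eR', mul_one]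
  have eSf : Sf = R * s⁻¹ * P * s⁻¹ * R := by
    rw [hP]
    simp only [mul_assoc, Matrix.mul_nonsing_inv_cancel_left, Matrix.nonsing_inv_mul_cancel_left,
      (Matrix.isUnit_iff_isUnit_det _).1 hsp.isUnit, (Matrix.isUnit_iff_isUnit_det _).1 hRp.isUnit,
      eR', mul_one]
  clear_value N
  -- Since `G⁻¹ = R⁻¹ s⁻¹ S s⁻¹ R⁻¹`, subtracting this matrix replaces `S` by `S - N`, the factor
  -- inverted in the product that defines `Q_0`.
  refine ⟨R⁻¹ * s⁻¹ * N * s⁻¹ * R⁻¹, ?_, ?_, ?_⟩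
  · have := posDef_conj hN (hRp.inv.isUnit.mul hsp.inv.isUnit)
    simpa only [Matrix.transpose_mul, hr, hsp.inv.transpose_eq, mul_assoc] using this
  · have : G⁻¹ - R⁻¹ * s⁻¹ * N * s⁻¹ * R⁻¹ = R⁻¹ * s⁻¹ * (S - N) * s⁻¹ * R⁻¹ := by
      rw [eG, mul_sub, sub_mul, sub_mul, ← hss]
      simp only [mul_assoc, Matrix.nonsing_inv_mul_cancel_left,
        Matrix.mul_nonsing_inv_cancel_left, (Matrix.isUnit_iff_isUnit_det _).1 hsp.isUnit]
    rw [this]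
    simp only [mul_assoc, Matrix.nonsing_inv_mul_cancel_left,
        Matrix.mul_nonsing_inv_cancel_left, (Matrix.isUnit_iff_isUnit_det _).1 hsp.isUnit,
        (Matrix.isUnit_iff_isUnit_det _).1 hRp.isUnit, (Matrix.isUnit_iff_isUnit_det _).1 hF, eR]
  · rw [eSf, ← hNN, eS, ← hss, ← hRR]
    simp only [mul_assoc, mul_add, add_mul, Matrix.nonsing_inv_mul_cancel_left,
        Matrix.mul_nonsing_inv_cancel_left, (Matrix.isUnit_iff_isUnit_det _).1 hsp.isUnit,
        (Matrix.isUnit_iff_isUnit_det _).1 hRp.isUnit]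

/-! ### Invertibility of differences -/

/-- If `q⁻¹ < g⁻¹` then `q - g` is invertible, with an inverse exceeding `-g⁻¹`. -/
theorem sub_mul_inverse {n : ℕ} {q g p : Mat n n} (hqp : q * p = 1) (hg : IsUnit g)
    (hX : IsUnit (g⁻¹ - p)) :
    (q - g) * (-g⁻¹ + g⁻¹ * (g⁻¹ - p)⁻¹ * g⁻¹) = 1 := by
  set X := g⁻¹ - p with hXd
  have eg := mul_inv_of_isUnit hg
  have e : q - g = q * X * g := by
    rw [hXd, mul_sub, hqp, sub_mul, one_mul, mul_assoc, inv_mul_of_isUnit hg, mul_one]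
  have e1 : q * X = q * g⁻¹ - 1 := by rw [hXd, mul_sub, hqp]
  rw [mul_add, e]
  simp only [mul_neg, mul_assoc, eg, mul_one]
  have : g * (g⁻¹ * (X⁻¹ * g⁻¹)) = X⁻¹ * g⁻¹ := by rw [← mul_assoc, eg, one_mul]
  rw [this, ← mul_assoc X, mul_inv_of_isUnit hX, one_mul, e1]
  abel

/-- `D - bᵀ g⁻¹ b ≥ 0` when `b D⁻¹ bᵀ ≤ g`. -/
theorem posSemidef_schur {n m : ℕ} {D : Mat m m} {g : Mat n n} {b : Mat n m} (hD : D.PosDef)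
    (hg : g.PosDef) (h : (g - b * D⁻¹ * bᵀ).PosSemidef) : (D - bᵀ * g⁻¹ * b).PosSemidef := by
  have := hD.isUnit.invertible
  have := hg.isUnit.invertible
  have h1 := (Matrix.PosDef.fromBlocks₂₂ g b hD).2 (by simpa using h)
  have h2 := (Matrix.PosDef.fromBlocks₁₁ b D hg).1 h1
  simpa using h2

/-- The bracket is the form of `(q - g)⁻¹` found in `sub_mul_inverse`. Its negative part is absorbed
by `D` through the Schur complement; its positive part stays definite because `b` is injective. -/
theorem posDef_schur_add {n m : ℕ} {D : Mat m m} {g X : Mat n n} {b : Mat n m} (hD : D.PosDef)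
    (hg : g.PosDef) (hX : X.PosDef) (hb : Function.Injective b.mulVec)
    (h : (g - b * D⁻¹ * bᵀ).PosSemidef) :
    (D + bᵀ * (-g⁻¹ + g⁻¹ * X⁻¹ * g⁻¹) * b).PosDef := by
  have h1 := posSemidef_schur hD hg h
  have h2 := posDef_conj hX.inv hg.inv.isUnit
  rw [hg.inv.transpose_eq] at h2
  have h3 := (posDef_conj' h2 hb).posSemidef_add h1
  convert h3 using 1
  rw [Matrix.mul_add, Matrix.add_mul, Matrix.mul_neg, Matrix.neg_mul]
  abel

/-- Antitonicity of the inverse is the Schur complement criterion with `b = 1` and `D = g⁻¹`. -/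
theorem posSemidef_inv_sub {n : ℕ} {g G : Mat n n} (hg : g.PosDef) (hG : G.PosDef)
    (h : (G - g).PosSemidef) : (g⁻¹ - G⁻¹).PosSemidef := by
  have := posSemidef_schur (b := 1) hg.inv hG
    (by simpa [Matrix.nonsing_inv_nonsing_inv _ ((Matrix.isUnit_iff_isUnit_det _).1 hg.isUnit)]
      using h)
  simpa using this

/-- Here `X = g⁻¹ - q⁻¹ = W + (g⁻¹ - G⁻¹)`, a positive definite matrix plus a semidefinite one. -/
theorem sub_initial_of_posDef {n : ℕ} {G W q g : Mat n n} (hG : G.PosDef) (hW : W.PosDef)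
    (hq : q * (G⁻¹ - W) = 1) (hg : g.PosDef) (hgG : (G - g).PosSemidef) :
    ∃ X : Mat n n, X.PosDef ∧ (q - g) * (-g⁻¹ + g⁻¹ * X⁻¹ * g⁻¹) = 1 := by
  have hX : (g⁻¹ - (G⁻¹ - W)).PosDef := by
    have := hW.posSemidef_add (posSemidef_inv_sub hg hG hgG)
    convert this using 1; abel
  exact ⟨_, hX, sub_mul_inverse hq hg.isUnit hX.isUnit⟩

theorem sub_final_eq {n : ℕ} {G W q : Mat n n} (hG : IsUnit G) (hq : q * (G⁻¹ - W) = 1) :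
    q - G = q * W * G := by
  have h1 : q * G⁻¹ = 1 + q * W := by rw [← hq]; noncomm_ring
  have h2 : q * G⁻¹ * G = q := by rw [mul_assoc, inv_mul_of_isUnit hG, mul_one]
  have h3 : q = G + q * W * G := by
    conv_lhs => rw [← h2, h1, add_mul, one_mul]
  rw [eq_comm, eq_sub_iff_add_eq, add_comm]
  exact h3.symm

/-- In initial coordinates `q - G` is the terminal matrix `Q_T`; this inverse starts the argument
that runs backward in time. -/
theorem sub_final_mul {n : ℕ} {G W q : Mat n n} (hG : IsUnit G) (hW : IsUnit W)
    (hq : q * (G⁻¹ - W) = 1) : (q - G) * (G⁻¹ * W⁻¹ * G⁻¹ - G⁻¹) = 1 := by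
  have h4 : q * W * G * (G⁻¹ * W⁻¹ * G⁻¹) = q * G⁻¹ := by
    simp only [mul_assoc, Matrix.mul_nonsing_inv_cancel_left, (Matrix.isUnit_iff_isUnit_det _).1 hW,
      (Matrix.isUnit_iff_isUnit_det _).1 hG]
  rw [sub_final_eq hG hq, mul_sub, h4, mul_assoc _ G, mul_inv_of_isUnit hG, mul_one, ← hq, mul_sub]

/-- The time reversal of `sub_initial_of_posDef`: write `q - g = -((G - q) - (G - g))`. The role of
`W` passes to `G⁻¹ W⁻¹ G⁻¹`, because `(G - q)⁻¹ = G⁻¹ - G⁻¹ W⁻¹ G⁻¹`. -/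
theorem sub_initial_of_posDef_compl {n : ℕ} {G W q g : Mat n n} (hG : G.PosDef) (hW : W.PosDef)
    (hq : q * (G⁻¹ - W) = 1) (hg : g.PosSemidef) (hgG : (G - g).PosDef) :
    ∃ X : Mat n n, X.PosDef ∧
      (q - g) * -(-(G - g)⁻¹ + (G - g)⁻¹ * X⁻¹ * (G - g)⁻¹) = 1 := by
  have hX : ((G - g)⁻¹ - -(G⁻¹ * W⁻¹ * G⁻¹ - G⁻¹)).PosDef := by
    have h1 := posSemidef_inv_sub hgG hG (by simpa using hg)
    have h2 := posDef_conj hW.inv hG.inv.isUnit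
    rw [hG.inv.transpose_eq] at h2
    convert h2.posSemidef_add h1 using 1; abel
  refine ⟨_, hX, ?_⟩
  have h := sub_mul_inverse (q := -(q - G)) (g := G - g) (p := -(G⁻¹ * W⁻¹ * G⁻¹ - G⁻¹))
    (by rw [neg_mul_neg]; exact sub_final_mul hG.isUnit hW.isUnit hq) hgG.isUnit hX.isUnit
  rw [mul_neg, ← neg_mul, ← h]
  congr 1
  abel

/-- The invertibility of `D + bᵀ q'⁻¹ b` is a consequence here and not an assumption, so the
identity can be used to prove positivity of the precision. -/
theorem woodbury_mul {n m : ℕ} {q q' : Mat n n} {D : Mat m m} {b : Mat n m} (hq : IsUnit q)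
    (hq' : IsUnit q') (hD : IsUnit D) (h : q' = q - b * D⁻¹ * bᵀ) :
    (D + bᵀ * q'⁻¹ * b) * (D⁻¹ - D⁻¹ * (bᵀ * q⁻¹ * b) * D⁻¹) = 1 := by
  have h1 : bᵀ * q'⁻¹ * b * (D⁻¹ * (bᵀ * q⁻¹ * b) * D⁻¹)
      = bᵀ * q'⁻¹ * b * D⁻¹ - bᵀ * q⁻¹ * b * D⁻¹ := by
    have h2 : b * D⁻¹ * bᵀ = q - q' := by rw [h]; abel
    have h3 : bᵀ * q'⁻¹ * b * (D⁻¹ * (bᵀ * q⁻¹ * b) * D⁻¹)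
        = bᵀ * (q'⁻¹ * (b * D⁻¹ * bᵀ) * q⁻¹) * b * D⁻¹ := by
      simp only [Matrix.mul_assoc]
    rw [h3, h2, mul_sub, sub_mul, inv_mul_of_isUnit hq', mul_assoc, mul_inv_of_isUnit hq, mul_one,
      one_mul, Matrix.mul_sub, Matrix.sub_mul, Matrix.sub_mul]
  have h4 : D * (D⁻¹ * (bᵀ * q⁻¹ * b) * D⁻¹) = bᵀ * q⁻¹ * b * D⁻¹ := by
    simp only [← Matrix.mul_assoc, mul_inv_of_isUnit hD, Matrix.one_mul]
  rw [mul_sub, add_mul, add_mul, mul_inv_of_isUnit hD, h1, h4]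
  abel

/-- The gain identities of the closed loop, by the Woodbury formula. -/
theorem woodbury_inv {n m : ℕ} {q q' : Mat n n} {D : Mat m m} {b : Mat n m}
    (hq' : IsUnit q') (hD : IsUnit D) (h : q' = q - b * D⁻¹ * bᵀ)
    (hW : IsUnit (D + bᵀ * q'⁻¹ * b)) :
    q⁻¹ = q'⁻¹ - q'⁻¹ * b * (D + bᵀ * q'⁻¹ * b)⁻¹ * bᵀ * q'⁻¹ := by
  have hD' : D⁻¹⁻¹ = D := Matrix.nonsing_inv_nonsing_inv _ ((Matrix.isUnit_iff_isUnit_det _).1 hD)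
  have e : q = q' + b * D⁻¹ * bᵀ := by rw [h]; abel
  have := Matrix.add_mul_mul_inv_eq_sub q' b D⁻¹ bᵀ hq' ((Matrix.isUnit_nonsing_inv_iff).2 hD)
    (by rwa [hD'])
  rw [hD'] at this
  rw [← this, ← e]

/-- By Woodbury, the inverse of the precision is `D⁻¹ - D⁻¹ bᵀ (q - g)⁻¹ b D⁻¹`. The backward
formula for `(q - g)⁻¹` carries the opposite sign, so this is a congruence by `D⁻¹` of the matrix in
`posDef_schur_add` with `G - g` as Gramian. -/
theorem precision_posDef_of_compl {n m : ℕ} {G W q g : Mat n n} {D : Mat m m} {b : Mat n m}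
    (hG : G.PosDef) (hW : W.PosDef)
    (hq : q * (G⁻¹ - W) = 1) (hg : g.PosSemidef) (hgG : (G - g).PosDef) (hD : D.PosDef)
    (hb : Function.Injective b.mulVec) (h' : (G - (g + b * D⁻¹ * bᵀ)).PosSemidef)
    (hu : IsUnit (q - (g + b * D⁻¹ * bᵀ))) :
    (D + bᵀ * (q - (g + b * D⁻¹ * bᵀ))⁻¹ * b).PosDef := by
  obtain ⟨X, hX, hXe⟩ := sub_initial_of_posDef_compl hG hW hq hg hgG
  obtain ⟨hu', hinv⟩ := isUnit_iff_exists_inv _ hXe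
  have h1 := posDef_schur_add (b := b) hD hgG hX hb (by convert h' using 1; abel)
  have h2 := posDef_conj h1 hD.inv.isUnit
  have h3 : D⁻¹ * (D + bᵀ * (-(G - g)⁻¹ + (G - g)⁻¹ * X⁻¹ * (G - g)⁻¹) * b) * (D⁻¹)ᵀ
      = D⁻¹ - D⁻¹ * (bᵀ * (q - g)⁻¹ * b) * D⁻¹ := by
    rw [hD.inv.transpose_eq, mul_add, add_mul, inv_mul_of_isUnit hD.isUnit, one_mul, hinv]
    simp only [Matrix.mul_neg, Matrix.neg_mul, sub_neg_eq_add]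
  rw [h3] at h2
  have h4 := woodbury_mul (b := b) hu' hu hD.isUnit (by abel)
  have h5 := Matrix.inv_eq_left_inv h4
  rw [← h5]
  exact h2.inv

/-! ### Transition matrices, Gramians and the Lyapunov recursion -/

theorem fwd_isUnit {n : ℕ} {A : ℕ → Mat n n} {k : ℕ} (hA : ∀ j < k, IsUnit (A j)) :
    IsUnit (fwd A 0 k) := by
  induction k with
  | zero => exact isUnit_one
  | succ k ih =>
    rw [fwd, Nat.zero_add]
    exact (hA k (by omega)).mul (ih fun j hj => hA j (by omega))

theorem fwd_mul_fwd {n : ℕ} (A : ℕ → Mat n n) (l d : ℕ) :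
    fwd A l d * fwd A 0 l = fwd A 0 (l + d) := by
  induction d with
  | zero => simp [fwd]
  | succ d ih => rw [fwd, mul_assoc, ih, ← add_assoc, fwd, Nat.zero_add]

theorem bwd_zero_eq {n : ℕ} (A : ℕ → Mat n n) (k : ℕ) : bwd A 0 k = (fwd A 0 k)⁻¹ := by
  induction k with
  | zero => simp [bwd, fwd]
  | succ k ih => rw [bwd, fwd, Nat.zero_add, Matrix.mul_inv_rev, ih]

theorem Phi_zero_left {n : ℕ} (A : ℕ → Mat n n) (k : ℕ) : Phi A 0 k = (fwd A 0 k)⁻¹ := by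
  rw [Phi]
  split_ifs with h
  · obtain rfl : k = 0 := by omega
    simp [fwd]
  · rw [Nat.sub_zero, bwd_zero_eq]

theorem Phi_of_le {n : ℕ} {A : ℕ → Mat n n} {k l : ℕ} (hA : ∀ j < l, IsUnit (A j)) (h : l ≤ k) :
    Phi A k l = fwd A 0 k * (fwd A 0 l)⁻¹ := by
  rw [Phi, if_pos h]
  have := fwd_mul_fwd A l (k - l)
  rw [Nat.add_sub_cancel' h] at this
  rw [← this, mul_assoc, mul_inv_of_isUnit (fwd_isUnit hA), mul_one]

theorem Gc_zero {n m : ℕ} (A : ℕ → Mat n n) (B : ℕ → Mat n m) : Gc A B 0 0 = 0 := by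
  simp [Gc]

theorem Gc_succ {n m : ℕ} (A : ℕ → Mat n n) (B : ℕ → Mat n m) (k : ℕ) :
    Gc A B (k + 1) 0 = Gc A B k 0
      + (fwd A 0 (k + 1))⁻¹ * B k * (B k)ᵀ * ((fwd A 0 (k + 1))⁻¹)ᵀ := by
  rw [Gc, Finset.sum_Ico_succ_top (Nat.zero_le k), Gc, Phi_zero_left]

theorem Gc_sub {n m : ℕ} (A : ℕ → Mat n n) (B : ℕ → Mat n m) {k l : ℕ} (h : k ≤ l) :
    Gc A B l 0 - Gc A B k 0 = ∑ j ∈ Finset.Ico k l,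
      Phi A 0 (j + 1) * B j * (B j)ᵀ * (Phi A 0 (j + 1))ᵀ := by
  rw [Gc, Gc, sub_eq_iff_eq_add', Finset.sum_Ico_consecutive _ (Nat.zero_le _) h]

theorem Gc_sub_posSemidef {n m : ℕ} (A : ℕ → Mat n n) (B : ℕ → Mat n m) {k l : ℕ} (h : k ≤ l) :
    (Gc A B l 0 - Gc A B k 0).PosSemidef := by
  rw [Gc_sub A B h]
  refine Matrix.posSemidef_sum _ fun j _ => ?_
  have := posSemidef_conj (posSemidef_conj Matrix.PosSemidef.one (B j)) (Phi A 0 (j + 1))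
  simpa only [Matrix.mul_one, Matrix.mul_assoc] using this

theorem Gc_posSemidef {n m : ℕ} (A : ℕ → Mat n n) (B : ℕ → Mat n m) (k : ℕ) :
    (Gc A B k 0).PosSemidef := by
  simpa [Gc_zero] using Gc_sub_posSemidef A B (Nat.zero_le k)

/-- Carried back to time `0`, reachability Gramians become differences of one increasing family, so
the invertibility assumptions can be compared. -/
theorem Gr_eq {n m : ℕ} {A : ℕ → Mat n n} (B : ℕ → Mat n m) {k l : ℕ}
    (hA : ∀ j < l, IsUnit (A j)) (h : k ≤ l) :
    Gr A B l k = fwd A 0 l * (Gc A B l 0 - Gc A B k 0) * (fwd A 0 l)ᵀ := by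
  rw [Gc_sub A B h, Gr, Matrix.mul_sum, Matrix.sum_mul]
  refine Finset.sum_congr rfl fun j hj => ?_
  rw [Finset.mem_Ico] at hj
  rw [Phi_of_le (fun i hi => hA i (by omega)) (by omega : j + 1 ≤ l), Phi_zero_left]
  simp only [Matrix.transpose_mul, Matrix.mul_assoc]

theorem isUnit_of_conj {n : ℕ} {U M V : Mat n n} (h : IsUnit (U * M * V)) : IsUnit M :=
  isUnit_of_mul_isUnit_right (isUnit_of_mul_isUnit_left h)

theorem lyap_succ {n m : ℕ} (T : ℕ) (A : ℕ → Mat n n) (B : ℕ → Mat n m) (Sini Sfin : Mat n n)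
    (k : ℕ) : lyap T A B Sini Sfin (k + 1) =
      A k * lyap T A B Sini Sfin k * (A k)ᵀ - B k * (B k)ᵀ := rfl

/-- Undoing the dynamics removes the `A k` from the recursion and leaves a running sum of the input
terms. -/
theorem lyap_eq {n m : ℕ} {T : ℕ} {A : ℕ → Mat n n} {B : ℕ → Mat n m} {Sini Sfin : Mat n n}
    {k : ℕ} (hA : ∀ j < k, IsUnit (A j)) :
    lyap T A B Sini Sfin k =
      fwd A 0 k * (lyap T A B Sini Sfin 0 - Gc A B k 0) * (fwd A 0 k)ᵀ := by
  induction k with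
  | zero => simp [fwd, Gc_zero]
  | succ k ih =>
    have hF := fwd_isUnit hA
    have e : ∀ M : Mat n n, fwd A 0 (k + 1) * ((fwd A 0 (k + 1))⁻¹ * M
        * ((fwd A 0 (k + 1))⁻¹)ᵀ) * (fwd A 0 (k + 1))ᵀ = M := fun M => by
      rw [← mul_assoc, ← mul_assoc, mul_inv_of_isUnit hF, mul_assoc, ← Matrix.transpose_mul,
        mul_inv_of_isUnit hF]
      simp
    rw [lyap_succ, ih fun j hj => hA j (by omega), Gc_succ, ← sub_sub, mul_sub (fwd A 0 (k + 1)),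
      sub_mul, Matrix.mul_assoc _ (B k), e (B k * (B k)ᵀ), fwd, Nat.zero_add]
    simp only [Matrix.transpose_mul, mul_assoc]

theorem inputRho_mul_transpose {n m : ℕ} (B : ℕ → Mat n m) {Srho : ℕ → Mat m m} {k : ℕ}
    (h : (Srho k).PosDef) :
    inputRho B Srho k * (inputRho B Srho k)ᵀ = B k * ((Srho k)⁻¹ + 1)⁻¹ * (B k)ᵀ := by
  have hD : ((Srho k)⁻¹ + 1).PosDef := h.inv.add Matrix.PosDef.one
  rw [inputRho, Matrix.transpose_mul, (msqrt_posDef hD).inv.transpose_eq, Matrix.mul_assoc,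
    ← Matrix.mul_assoc (msqrt _)⁻¹, ← Matrix.mul_inv_rev, msqrt_mul_self hD.posSemidef,
    ← Matrix.mul_assoc]

theorem mulVec_injective_of_rank {n m : ℕ} {B : Mat n m} (h : B.rank = m) :
    Function.Injective B.mulVec := by
  rw [Matrix.mulVec_injective_iff, linearIndependent_iff_card_eq_finrank_span,
    Fintype.card_fin]
  rw [Matrix.rank_eq_finrank_span_cols] at h
  exact h.symm

/-- The structure of the Lyapunov recursion in the coordinates of the initial time. -/
structure LyapData {n m : ℕ} (T : ℕ) (A : ℕ → Mat n n) (B : ℕ → Mat n m) (Srho : ℕ → Mat m m)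
    (Sini Sfin : Mat n n) (W : Mat n n) : Prop where
  gram_posDef : (Gc A (inputRho B Srho) T 0).PosDef
  split_posDef : W.PosDef
  lyap_zero_mul : lyap T A (inputRho B Srho) Sini Sfin 0 * ((Gc A (inputRho B Srho) T 0)⁻¹ - W) = 1
  final_eq : Phi A 0 T * Sfin * (Phi A 0 T)ᵀ = Gc A (inputRho B Srho) T 0 *
    (W * Sini * W + W) * Gc A (inputRho B Srho) T 0

theorem exists_lyapData {n m : ℕ} {T : ℕ} {A : ℕ → Mat n n} {B : ℕ → Mat n m}
    {Srho : ℕ → Mat m m} {Sini Sfin : Mat n n} (hSini : Sini.PosDef) (hSfin : Sfin.PosDef)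
    (hA : ∀ k < T, IsUnit (A k)) (hG : IsUnit (Gr A (inputRho B Srho) T 0))
    (hF : IsUnit (Fminus T A (inputRho B Srho) Sini Sfin)) :
    ∃ W, LyapData T A B Srho Sini Sfin W := by
  have hGp : (Gc A (inputRho B Srho) T 0).PosDef := by
    rw [(Gc_posSemidef A _ T).posDef_iff_isUnit]
    rw [Gr_eq _ hA (Nat.zero_le T), Gc_zero, sub_zero] at hG
    exact isUnit_of_conj hG
  have hSf : (Phi A 0 T * Sfin * (Phi A 0 T)ᵀ).PosDef := by
    refine posDef_conj hSfin ?_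
    rw [Phi_zero_left]
    exact (Matrix.isUnit_nonsing_inv_iff).2 (fwd_isUnit hA)
  obtain ⟨W, h1, h2, h3⟩ := exists_initial_split hGp hSini hSf
    (S := S0 T A (inputRho B Srho) Sini) (M := midRoot T A (inputRho B Srho) Sini Sfin) rfl rfl
    (by simp only [midRoot, ST, Matrix.mul_assoc]) hF
  exact ⟨W, hGp, h1, h2, h3⟩

section

variable {n m T : ℕ} {A : ℕ → Mat n n} {B : ℕ → Mat n m} {Srho : ℕ → Mat m m}
  {Sini Sfin W : Mat n n}

theorem LyapData.isUnit_sub (h : LyapData T A B Srho Sini Sfin W) {k : ℕ} (hk : k ≤ T)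
    (hor : (Gc A (inputRho B Srho) k 0).PosDef ∨
      (Gc A (inputRho B Srho) T 0 - Gc A (inputRho B Srho) k 0).PosDef) :
    IsUnit (lyap T A (inputRho B Srho) Sini Sfin 0 - Gc A (inputRho B Srho) k 0) := by
  rcases hor with hg | hg
  · obtain ⟨X, _, hX⟩ := sub_initial_of_posDef h.gram_posDef h.split_posDef h.lyap_zero_mul hg
      (Gc_sub_posSemidef _ _ hk)
    exact (isUnit_iff_exists_inv _ hX).1
  · obtain ⟨X, _, hX⟩ := sub_initial_of_posDef_compl h.gram_posDef h.split_posDef h.lyap_zero_mul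
      (Gc_posSemidef _ _ _) hg
    exact (isUnit_iff_exists_inv _ hX).1

/-- Positive semidefinite and invertible means positive definite. The two ranges of `k` together
cover the whole horizon. -/
theorem posDef_or_posDef_compl (hA : ∀ k < T, IsUnit (A k)) {kr : ℕ}
    (h1 : ∀ k, kr ≤ k → k ≤ T → IsUnit (Gr A (inputRho B Srho) k 0))
    (h2 : ∀ k, k ≤ kr - 1 → IsUnit (Gr A (inputRho B Srho) T k)) {k : ℕ} (hk : k ≤ T) :
    (kr ≤ k → (Gc A (inputRho B Srho) k 0).PosDef) ∧
    (k ≤ kr - 1 → (Gc A (inputRho B Srho) T 0 - Gc A (inputRho B Srho) k 0).PosDef) := by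
  constructor
  · intro hk'
    rw [(Gc_posSemidef A _ k).posDef_iff_isUnit]
    have := h1 k hk' hk
    rw [Gr_eq _ (fun j hj => hA j (by omega)) (Nat.zero_le k), Gc_zero, sub_zero] at this
    exact isUnit_of_conj this
  · intro hk'
    rw [(Gc_sub_posSemidef A _ hk).posDef_iff_isUnit]
    have := h2 k hk'
    rw [Gr_eq _ hA hk] at this
    exact isUnit_of_conj this

theorem LyapData.isUnit_lyap (h : LyapData T A B Srho Sini Sfin W)
    (hA : ∀ k < T, IsUnit (A k)) {kr : ℕ}
    (h1 : ∀ k, kr ≤ k → k ≤ T → IsUnit (Gr A (inputRho B Srho) k 0))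
    (h2 : ∀ k, k ≤ kr - 1 → IsUnit (Gr A (inputRho B Srho) T k)) {k : ℕ} (hk : k ≤ T) :
    IsUnit (lyap T A (inputRho B Srho) Sini Sfin 0 - Gc A (inputRho B Srho) k 0) ∧
    IsUnit (lyap T A (inputRho B Srho) Sini Sfin k) := by
  have h3 := posDef_or_posDef_compl hA h1 h2 hk
  have h4 : IsUnit (lyap T A (inputRho B Srho) Sini Sfin 0 - Gc A (inputRho B Srho) k 0) := by
    rcases le_or_gt kr k with h5 | h5
    · exact h.isUnit_sub hk (Or.inl (h3.1 h5))
    · exact h.isUnit_sub hk (Or.inr (h3.2 (by omega)))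
  have hF := fwd_isUnit (A := A) (k := k) fun j hj => hA j (by omega)
  refine ⟨h4, ?_⟩
  rw [lyap_eq fun j hj => hA j (by omega)]
  exact (hF.mul h4).mul ((Matrix.isUnit_transpose _).2 hF)

theorem LyapData.precision_posDef (h : LyapData T A B Srho Sini Sfin W)
    (hSrho : ∀ k < T, (Srho k).PosDef) (hB : ∀ k < T, (B k).rank = m)
    (hA : ∀ k < T, IsUnit (A k)) {kr : ℕ}
    (h1 : ∀ k, kr ≤ k → k ≤ T → IsUnit (Gr A (inputRho B Srho) k 0))
    (h2 : ∀ k, k ≤ kr - 1 → IsUnit (Gr A (inputRho B Srho) T k)) {k : ℕ} (hk : k < T) :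
    (precision T A B Srho Sini Sfin k).PosDef := by
  have hD : ((Srho k)⁻¹ + 1).PosDef := (hSrho k hk).inv.add Matrix.PosDef.one
  set F := fwd A 0 (k + 1) with hFd
  have hF : IsUnit F := fwd_isUnit fun j hj => hA j (by omega)
  have hF' : IsUnit F⁻¹ := (Matrix.isUnit_nonsing_inv_iff).2 hF
  set b := F⁻¹ * B k with hb
  have hbi : Function.Injective b.mulVec := by
    have e : b.mulVec = F⁻¹.mulVec ∘ (B k).mulVec := by
      funext v; simp [hb, Matrix.mulVec_mulVec]
    rw [e]
    exact (Matrix.mulVec_injective_of_isUnit hF').comp (mulVec_injective_of_rank (hB k hk))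
  have hG : Gc A (inputRho B Srho) (k + 1) 0
      = Gc A (inputRho B Srho) k 0 + b * ((Srho k)⁻¹ + 1)⁻¹ * bᵀ := by
    rw [Gc_succ, Matrix.mul_assoc _ (inputRho B Srho k), inputRho_mul_transpose B (hSrho k hk), hb,
      Matrix.transpose_mul]
    simp only [Matrix.mul_assoc, hFd]
  have hu := (h.isUnit_lyap hA h1 h2 (k := k + 1) hk).1
  have hp : precision T A B Srho Sini Sfin k = (Srho k)⁻¹ + 1 + bᵀ *
      (lyap T A (inputRho B Srho) Sini Sfin 0 - Gc A (inputRho B Srho) (k + 1) 0)⁻¹ * b := by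
    rw [precision, lyap_eq fun j hj => hA j (by omega), Matrix.mul_inv_rev, Matrix.mul_inv_rev,
      hb, Matrix.transpose_mul, ← Matrix.transpose_nonsing_inv]
    simp only [Matrix.mul_assoc, hFd]
  rw [hp]
  -- The Schur bound needs a Gramian that contains the contribution of step `k`: either the one up
  -- to time `k + 1`, or the complement from time `k` on.
  rcases le_or_gt kr (k + 1) with h5 | h5
  · have hg := (posDef_or_posDef_compl hA h1 h2 (k := k + 1) hk).1 h5
    obtain ⟨X, hXp, hX⟩ := sub_initial_of_posDef h.gram_posDef h.split_posDef h.lyap_zero_mul hg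
      (Gc_sub_posSemidef _ _ hk)
    rw [(isUnit_iff_exists_inv _ hX).2]
    refine posDef_schur_add hD hg hXp hbi ?_
    rw [hG, add_sub_cancel_right]
    exact Gc_posSemidef _ _ _
  · have hg := (posDef_or_posDef_compl hA h1 h2 (k := k) hk.le).2 (by omega)
    have hs := Gc_sub_posSemidef A (inputRho B Srho) (k := k + 1) hk
    rw [hG] at hu hs ⊢
    exact precision_posDef_of_compl h.gram_posDef h.split_posDef h.lyap_zero_mul
      (Gc_posSemidef _ _ _) hg hD hbi hs hu

/-- Symmetry of `Q_0` is read off its inverse `G⁻¹ - W`. -/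
theorem LyapData.lyap_transpose (h : LyapData T A B Srho Sini Sfin W)
    (k : ℕ) : (lyap T A (inputRho B Srho) Sini Sfin k)ᵀ = lyap T A (inputRho B Srho) Sini Sfin k := by
  induction k with
  | zero =>
    rw [← Matrix.inv_eq_left_inv h.lyap_zero_mul, Matrix.transpose_nonsing_inv,
      Matrix.transpose_sub, h.split_posDef.transpose_eq, h.gram_posDef.inv.transpose_eq]
  | succ k ih =>
    rw [lyap, Matrix.transpose_sub, Matrix.transpose_mul, Matrix.transpose_mul,
      Matrix.transpose_mul, ih]
    simp only [Matrix.transpose_transpose, mul_assoc]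

end

/-! ### Covariance of the closed loop -/

/-- The feedback gain of the policy. -/
noncomputable def gain {n m : ℕ} (T : ℕ) (A : ℕ → Mat n n) (B : ℕ → Mat n m) (Srho : ℕ → Mat m m)
    (Sini Sfin : Mat n n) (k : ℕ) : Mat m n :=
  -((precision T A B Srho Sini Sfin k)⁻¹ * (B k)ᵀ
      * (lyap T A (inputRho B Srho) Sini Sfin (k + 1))⁻¹ * A k)

/-- The state covariance of a linear system with feedback gains `K` and input covariances `S`. -/
noncomputable def stateCov {n m : ℕ} (A : ℕ → Mat n n) (B : ℕ → Mat n m) (K : ℕ → Mat m n) (S : ℕ → Mat m m)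
    (Sini : Mat n n) : ℕ → Mat n n
  | 0 => Sini
  | k + 1 => (A k + B k * K k) * stateCov A B K S Sini k * (A k + B k * K k)ᵀ
      + B k * S k * (B k)ᵀ

theorem stateCov_posSemidef {n m : ℕ} {A : ℕ → Mat n n} {B : ℕ → Mat n m} {K : ℕ → Mat m n}
    {S : ℕ → Mat m m} {Sini : Mat n n} {k : ℕ} (h0 : Sini.PosSemidef)
    (hS : ∀ j < k, (S j).PosSemidef) : (stateCov A B K S Sini k).PosSemidef := by
  induction k with
  | zero => exact h0
  | succ k ih =>
    exact (posSemidef_conj (ih fun j hj => hS j (by omega)) _).add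
      (posSemidef_conj (hS k (by omega)) _)

/-- With `R = A Q Aᵀ`, Woodbury gives `B P⁻¹ Bᵀ = Q' - Q' R⁻¹ Q'`, so the closed-loop matrix is `Q'
R⁻¹ A`. Since `R⁻¹ A Q = (A⁻¹)ᵀ`, the part `Q Y Q` is transported by `A⁻¹`, and the part `Q` yields
`Q' R⁻¹ Q'`, which cancels against the noise. -/
theorem closedLoop_step {n m : ℕ} {A Q Q' Y : Mat n n} {B : Mat n m} {D P : Mat m m}
    (hA : IsUnit A) (hQ : IsUnit Q) (hQ' : IsUnit Q') (hQt : Qᵀ = Q) (hQt' : Q'ᵀ = Q')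
    (hD : IsUnit D) (h : Q' = A * Q * Aᵀ - B * D⁻¹ * Bᵀ) (hPd : P = D + Bᵀ * Q'⁻¹ * B)
    (hP : IsUnit P) :
    (A + B * -(P⁻¹ * Bᵀ * Q'⁻¹ * A)) * (Q * Y * Q + Q) * (A + B * -(P⁻¹ * Bᵀ * Q'⁻¹ * A))ᵀ
        + B * P⁻¹ * Bᵀ
      = Q' * ((A⁻¹)ᵀ * Y * A⁻¹) * Q' + Q' := by
  set R := A * Q * Aᵀ with hR
  have hAt : IsUnit Aᵀ := (Matrix.isUnit_transpose _).2 hA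
  have hRu : IsUnit R := (hA.mul hQ).mul hAt
  have hRt : Rᵀ = R := by simp only [hR, Matrix.transpose_mul, hQt, Matrix.transpose_transpose,
    mul_assoc]
  have hRi : (R⁻¹)ᵀ = R⁻¹ := by rw [Matrix.transpose_nonsing_inv, hRt]
  have hwb := woodbury_inv hQ' hD h (hPd ▸ hP)
  rw [← hPd] at hwb
  have hN : B * P⁻¹ * Bᵀ = Q' - Q' * R⁻¹ * Q' := by
    rw [hwb]
    have e : Q' * (Q'⁻¹ - Q'⁻¹ * B * P⁻¹ * Bᵀ * Q'⁻¹) * Q'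
        = Q' * Q'⁻¹ * Q' - (Q' * Q'⁻¹) * (B * P⁻¹ * Bᵀ) * (Q'⁻¹ * Q') := by
      simp only [Matrix.mul_sub, Matrix.sub_mul, Matrix.mul_assoc]
    rw [e, mul_inv_of_isUnit hQ', inv_mul_of_isUnit hQ']
    simp
  have hcl : A + B * -(P⁻¹ * Bᵀ * Q'⁻¹ * A) = Q' * R⁻¹ * A := by
    have e : B * (P⁻¹ * Bᵀ * Q'⁻¹ * A) = (B * P⁻¹ * Bᵀ) * Q'⁻¹ * A := by
      simp only [Matrix.mul_assoc]
    rw [Matrix.mul_neg, e, hN, sub_mul, sub_mul, mul_inv_of_isUnit hQ', mul_assoc _ Q' Q'⁻¹,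
      mul_inv_of_isUnit hQ']
    simp
  have hRA : R⁻¹ * A * Q = (A⁻¹)ᵀ := by
    have e : R⁻¹ * A * Q * Aᵀ = 1 := by
      rw [mul_assoc, mul_assoc, ← mul_assoc A, ← hR, inv_mul_of_isUnit hRu]
    rw [Matrix.transpose_nonsing_inv]
    exact (Matrix.inv_eq_left_inv e).symm
  have hRA' : Q * Aᵀ * R⁻¹ = A⁻¹ := by
    have := congrArg Matrix.transpose hRA
    simpa only [Matrix.transpose_mul, hRi, hQt, Matrix.transpose_transpose, mul_assoc] using this
  have e1 : Q' * R⁻¹ * A * (Q * Y * Q + Q) * (Q' * R⁻¹ * A)ᵀ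
      = Q' * (R⁻¹ * A * Q) * Y * (Q * Aᵀ * R⁻¹) * Q' + Q' * (R⁻¹ * A * Q) * Aᵀ * R⁻¹ * Q' := by
    rw [Matrix.transpose_mul, Matrix.transpose_mul, hRi, hQt']
    noncomm_ring
  have e2 : (A⁻¹)ᵀ * Aᵀ = 1 := by
    rw [← Matrix.transpose_mul, mul_inv_of_isUnit hA, Matrix.transpose_one]
  rw [hcl, hN, e1, hRA, hRA', mul_assoc Q' _ Aᵀ, e2]
  noncomm_ring

theorem LyapData.stateCov_eq {n m T : ℕ} {A : ℕ → Mat n n} {B : ℕ → Mat n m}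
    {Srho : ℕ → Mat m m} {Sini Sfin W : Mat n n}
    (h : LyapData T A B Srho Sini Sfin W) (hA : ∀ k < T, IsUnit (A k))
    (hSrho : ∀ k < T, (Srho k).PosDef)
    (hQ : ∀ k ≤ T, IsUnit (lyap T A (inputRho B Srho) Sini Sfin k))
    (hP : ∀ k < T, (precision T A B Srho Sini Sfin k).PosDef) :
    stateCov A B (gain T A B Srho Sini Sfin) (fun k => (precision T A B Srho Sini Sfin k)⁻¹)
      Sini T = Sfin := by
  set Q := lyap T A (inputRho B Srho) Sini Sfin with hQd
  set G := Gc A (inputRho B Srho) T 0 with hG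
  -- Solves `Q_0 J Q_0 + Q_0 = Sini`, so that the invariant form of `closedLoop_step` holds at time
  -- `0`.
  set J := (Q 0)⁻¹ * Sini * (Q 0)⁻¹ - (Q 0)⁻¹ with hJ
  have hQ0 := hQ 0 (Nat.zero_le T)
  have key : ∀ k ≤ T, stateCov A B (gain T A B Srho Sini Sfin)
      (fun k => (precision T A B Srho Sini Sfin k)⁻¹) Sini k
      = Q k * (((fwd A 0 k)⁻¹)ᵀ * J * (fwd A 0 k)⁻¹) * Q k + Q k := by
    intro k
    induction k with
    | zero =>
      intro _
      simp only [stateCov, fwd, inv_one, Matrix.transpose_one, one_mul, mul_one, hJ, mul_sub,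
        sub_mul, mul_inv_of_isUnit hQ0, ← mul_assoc]
      simp [mul_assoc, inv_mul_of_isUnit hQ0]
    | succ k ih =>
      intro hk
      have hD : ((Srho k)⁻¹ + 1).PosDef := (hSrho k hk).inv.add Matrix.PosDef.one
      have hstep : Q (k + 1) = A k * Q k * (A k)ᵀ - B k * ((Srho k)⁻¹ + 1)⁻¹ * (B k)ᵀ := by
        rw [← inputRho_mul_transpose B (hSrho k hk)]; rfl
      have := closedLoop_step (Y := ((fwd A 0 k)⁻¹)ᵀ * J * (fwd A 0 k)⁻¹) (hA k hk)
        (hQ k (by omega)) (hQ (k + 1) hk) (h.lyap_transpose k) (h.lyap_transpose (k + 1))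
        hD.isUnit hstep rfl (hP k hk).isUnit
      rw [stateCov, ih (by omega), gain]
      refine this.trans ?_
      rw [fwd, Nat.zero_add, Matrix.mul_inv_rev, Matrix.transpose_mul]
      simp only [mul_assoc]
  rw [key T le_rfl]
  set F := fwd A 0 T with hFd
  have hF : IsUnit F := fwd_isUnit hA
  have hFt : Fᵀ * (F⁻¹)ᵀ = 1 := by
    rw [← Matrix.transpose_mul, inv_mul_of_isUnit hF, Matrix.transpose_one]
  have hFt' : (F⁻¹)ᵀ * Fᵀ = 1 := by
    rw [← Matrix.transpose_mul, mul_inv_of_isUnit hF, Matrix.transpose_one]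
  have hQT : Q T = F * (Q 0 - G) * Fᵀ := lyap_eq hA
  have hW : (Q 0)⁻¹ = G⁻¹ - W := Matrix.inv_eq_right_inv h.lyap_zero_mul
  have e1 : Q 0 - G = Q 0 * W * G := sub_final_eq h.gram_posDef.isUnit h.lyap_zero_mul
  have e2 : Q 0 - G = G * W * Q 0 := by
    have := congrArg Matrix.transpose e1
    have hQt : (Q 0)ᵀ = Q 0 := h.lyap_transpose 0
    have hGt : Gᵀ = G := h.gram_posDef.transpose_eq
    simpa only [Matrix.transpose_sub, Matrix.transpose_mul, hQt, hGt, h.split_posDef.transpose_eq, mul_assoc] using this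
  -- The relation `(Q_0 - G) Q_0⁻¹ = G W` eliminates `Q_0` and leaves the right-hand side of
  -- `final_eq`.
  have e3 : (Q 0 - G) * J * (Q 0 - G) + (Q 0 - G) = G * (W * Sini * W + W) * G := by
    have i1 : (Q 0 - G) * (Q 0)⁻¹ = G * W := by
      rw [e2, mul_assoc, mul_inv_of_isUnit hQ0, mul_one]
    have i2 : (Q 0)⁻¹ * (Q 0 - G) = W * G := by
      rw [e1, ← mul_assoc, ← mul_assoc, inv_mul_of_isUnit hQ0, one_mul]
    have i3 : (Q 0 - G) * J * (Q 0 - G) = ((Q 0 - G) * (Q 0)⁻¹) * Sini * ((Q 0)⁻¹ * (Q 0 - G))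
        - (Q 0 - G) * ((Q 0)⁻¹ * (Q 0 - G)) := by
      rw [hJ]; noncomm_ring
    have i4 : (Q 0 - G) * (W * G) = (Q 0 - G) - G * (W * G) := by
      rw [sub_mul, ← mul_assoc, ← e1]
    rw [i3, i1, i2, i4]; noncomm_ring
  have e4 : Q T * ((F⁻¹)ᵀ * J * F⁻¹) * Q T + Q T
      = F * ((Q 0 - G) * J * (Q 0 - G) + (Q 0 - G)) * Fᵀ := by
    have : Q T * ((F⁻¹)ᵀ * J * F⁻¹) * Q T
        = F * (Q 0 - G) * (Fᵀ * (F⁻¹)ᵀ) * J * (F⁻¹ * F) * (Q 0 - G) * Fᵀ := by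
      rw [hQT]; simp only [mul_assoc]
    rw [this, hFt, inv_mul_of_isUnit hF, hQT]
    noncomm_ring
  rw [e4, e3, ← h.final_eq, Phi_zero_left]
  have : F * (F⁻¹ * Sfin * (F⁻¹)ᵀ) * Fᵀ = (F * F⁻¹) * Sfin * ((F⁻¹)ᵀ * Fᵀ) := by
    simp only [mul_assoc]
  rw [this, hFt', mul_inv_of_isUnit hF, one_mul, mul_one]

/-! ### Gaussian densities and linear images -/

theorem map_withDensity_comp {α β : Type*} [MeasurableSpace α] [MeasurableSpace β]
    (μ : Measure α) {f : α → β} {g : β → ℝ≥0∞} (hf : Measurable f) (hg : Measurable g) :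
    (μ.withDensity fun x => g (f x)).map f = (μ.map f).withDensity g := by
  ext s hs
  rw [Measure.map_apply hf hs, withDensity_apply _ (hf hs), withDensity_apply _ hs,
    setLIntegral_map hs hg hf]

theorem exists_stdGaussian_density (n : ℕ) : ∃ c : ℝ,
    stdGaussian (Vec n) = volume.withDensity fun x => ENNReal.ofReal (Real.exp (c - ‖x‖ ^ 2 / 2)) := by
  set Z : ℝ := ∫ v : Vec n, Real.exp (-(1 / 2) * ‖v‖ ^ 2) with hZ
  have hZ' := GaussianFourier.integral_rexp_neg_mul_sq_norm (V := Vec n) (b := 1 / 2) (by norm_num)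
  rw [← hZ] at hZ'
  have hZpos : 0 < Z := by rw [hZ']; positivity
  -- A nonintegrable function has integral `0` by convention, whereas `Z` is positive.
  have hint : Integrable fun v : Vec n => Real.exp (-(1 / 2) * ‖v‖ ^ 2) := by
    by_contra h
    rw [hZ, integral_undef h] at hZpos
    exact lt_irrefl _ hZpos
  have hden : ∀ x : Vec n, Real.exp (-Real.log Z - ‖x‖ ^ 2 / 2)
      = Z⁻¹ * Real.exp (-(1 / 2) * ‖x‖ ^ 2) := fun x => by
    rw [sub_eq_add_neg, Real.exp_add, Real.exp_neg, Real.exp_log hZpos]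
    congr 2; ring
  refine ⟨-Real.log Z, ?_⟩
  simp only [hden]
  have hint2 : Integrable fun v : Vec n => Z⁻¹ * Real.exp (-(1 / 2) * ‖v‖ ^ 2) :=
    hint.const_mul _
  have : IsFiniteMeasure ((volume : Measure (Vec n)).withDensity
      fun x => ENNReal.ofReal (Z⁻¹ * Real.exp (-(1 / 2) * ‖x‖ ^ 2))) :=
    isFiniteMeasure_withDensity_ofReal hint2.2
  apply Measure.ext_of_charFun
  funext t
  rw [charFun_stdGaussian, charFun_apply, integral_withDensity_eq_integral_toReal_smul (by fun_prop)
    (by simp)]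
  have h1 := GaussianFourier.integral_cexp_neg_mul_sq_norm_add (V := Vec n) (b := 1 / 2)
    (by norm_num) Complex.I t
  have h2 := GaussianFourier.integral_cexp_neg_mul_sq_norm (V := Vec n) (b := 1 / 2) (by norm_num)
  have h3 : (Z : ℂ) = ∫ v : Vec n, Complex.exp (-(1 / 2) * ‖v‖ ^ 2) := by
    rw [hZ, ← integral_complex_ofReal]
    congr 1; funext v; push_cast; rfl
  rw [← h2, ← h3] at h1
  have h4 : ∀ x : Vec n, (ENNReal.ofReal (Z⁻¹ * Real.exp (-(1 / 2) * ‖x‖ ^ 2))).toReal •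
      Complex.exp ((inner ℝ x t : ℝ) * Complex.I)
      = (Z : ℂ)⁻¹ * Complex.exp (-(1 / 2) * ‖x‖ ^ 2 + Complex.I * (inner ℝ t x : ℝ)) := by
    intro x
    rw [ENNReal.toReal_ofReal (by positivity), Complex.real_smul, Complex.exp_add, real_inner_comm]
    push_cast
    rw [mul_comm Complex.I, mul_assoc]
  simp_rw [h4]
  rw [integral_const_mul, h1, ← mul_assoc, inv_mul_cancel₀ (by exact_mod_cast hZpos.ne'), one_mul]
  congr 1
  rw [Complex.I_sq]; ring

theorem measurable_sqNorm {n : ℕ} (M : Mat n n) : Measurable (sqNorm M) := by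
  unfold sqNorm
  simp only [dotProduct, Matrix.mulVec]
  fun_prop

/-- Change of variables along `z ↦ μ + S^{1/2} z`. The constant is chosen before the mean because
the mean will be a feedback term that varies with the state. -/
theorem exists_gaussian_density {n : ℕ} {S : Mat n n} (hS : S.PosDef) : ∃ c : ℝ, ∀ μ : Vec n,
    multivariateGaussian μ S = volume.withDensity fun x =>
      ENNReal.ofReal (Real.exp (c - sqNorm S⁻¹ (x - μ) / 2)) := by
  obtain ⟨c, hc⟩ := exists_stdGaussian_density n
  have hL := msqrt_posDef hS
  have hm := measurable_sqNorm S⁻¹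
  set L := Matrix.toEuclideanCLM (𝕜 := ℝ) (CFC.sqrt S) with hLd
  have hLof : ∀ z : Vec n, (L z).ofLp = msqrt S *ᵥ z.ofLp := fun z => by
    rw [hLd, Matrix.ofLp_toEuclideanCLM]; rfl
  have hnorm : ∀ z : Vec n, sqNorm S⁻¹ (L z) = ‖z‖ ^ 2 := fun z => by
    have e : msqrt S * S⁻¹ * msqrt S = 1 := by
      have hi : S⁻¹ = (msqrt S)⁻¹ * (msqrt S)⁻¹ := by
        rw [← Matrix.mul_inv_rev, msqrt_mul_self hS.posSemidef]
      rw [hi, ← mul_assoc, mul_inv_of_isUnit hL.isUnit, one_mul, inv_mul_of_isUnit hL.isUnit]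
    rw [sqNorm, hLof, Matrix.mulVec_mulVec, Matrix.dotProduct_mulVec, ← Matrix.mulVec_transpose,
      Matrix.mulVec_mulVec, Matrix.transpose_mul, hL.transpose_eq, hS.inv.transpose_eq, e,
      Matrix.one_mulVec, EuclideanSpace.real_norm_sq_eq]
    simp [dotProduct, sq]
  have hdet : LinearMap.det (L : Vec n →ₗ[ℝ] Vec n) ≠ 0 := by
    rw [hLd, Matrix.coe_toEuclideanCLM_eq_toEuclideanLin, LinearMap.det_toLpLin]
    exact ((Matrix.isUnit_iff_isUnit_det _).1 hL.isUnit).ne_zero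
  set a := |(LinearMap.det (L : Vec n →ₗ[ℝ] Vec n))⁻¹| with ha
  have hapos : 0 < a := abs_pos.2 (inv_ne_zero hdet)
  refine ⟨Real.log a + c, fun μ => ?_⟩
  have hvol : (volume : Measure (Vec n)).map (fun x => μ + L x) = ENNReal.ofReal a • volume := by
    have h1 : (volume : Measure (Vec n)).map (fun x => L x) = ENNReal.ofReal a • volume :=
      Measure.map_linearMap_addHaar_eq_smul_addHaar volume hdet
    have h2 : (fun x => μ + L x) = (fun y => μ + y) ∘ fun x => L x := rfl
    rw [h2, ← Measure.map_map (by fun_prop) (by fun_prop), h1, Measure.map_smul, map_add_left_eq_self]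
  have h3 := map_withDensity_comp (volume : Measure (Vec n)) (f := fun x => μ + L x)
    (g := fun y => ENNReal.ofReal (Real.exp (c - sqNorm S⁻¹ (y - μ) / 2))) (by fun_prop)
    (by fun_prop)
  simp only [add_sub_cancel_left, hnorm] at h3
  rw [← hc, hvol, withDensity_smul_measure, ← withDensity_smul' _ _ ENNReal.ofReal_ne_top] at h3
  rw [multivariateGaussian]
  refine h3.trans ?_
  congr 1
  funext x
  rw [Pi.smul_apply, smul_eq_mul, ← ENNReal.ofReal_mul hapos.le, add_sub_assoc, Real.exp_add,
    Real.exp_log hapos]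

/-- Two nondegenerate Gaussian laws have an explicit density, up to a normalization depending on
the covariances only. -/
theorem exists_gaussian_withDensity {n : ℕ} {S S' : Mat n n} (hS : S.PosDef) (hS' : S'.PosDef) :
    ∃ c : ℝ, ∀ μ μ' : Vec n, multivariateGaussian μ S =
      (multivariateGaussian μ' S').withDensity fun x => ENNReal.ofReal
        (Real.exp (c - sqNorm S⁻¹ (x - μ) / 2 + sqNorm S'⁻¹ (x - μ') / 2)) := by
  obtain ⟨c, hc⟩ := exists_gaussian_density hS
  obtain ⟨c', hc'⟩ := exists_gaussian_density hS'
  have hm := measurable_sqNorm S⁻¹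
  have hm' := measurable_sqNorm S'⁻¹
  refine ⟨c - c', fun μ μ' => ?_⟩
  rw [hc μ, hc' μ', ← withDensity_mul _ (by fun_prop) (by fun_prop)]
  congr 1
  funext x
  rw [Pi.mul_apply, ← ENNReal.ofReal_mul (Real.exp_pos _).le, ← Real.exp_add]
  congr 2; ring

theorem inner_toEuclideanLin_left {n m : ℕ} (M : Mat n m) (x : Vec m) (t : Vec n) :
    inner ℝ (M.toEuclideanLin x) t = inner ℝ x (Mᵀ.toEuclideanLin t) := by
  simp only [EuclideanSpace.inner_eq_star_dotProduct, star_trivial,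
    Matrix.ofLp_toLpLin, Matrix.toLin'_apply]
  rw [Matrix.dotProduct_mulVec, Matrix.mulVec_transpose]

theorem charFun_map_gaussian {n m : ℕ} (M : Mat n m) {S : Mat m m} (hS : S.PosSemidef)
    (t : Vec n) : charFun ((multivariateGaussian 0 S).map fun x => M.toEuclideanLin x) t =
      Complex.exp (-((t.ofLp ⬝ᵥ (M * S * Mᵀ) *ᵥ t.ofLp : ℝ) : ℂ) / 2) := by
  have hM : Measurable fun x : Vec m => M.toEuclideanLin x :=
    (LinearMap.continuous_of_finiteDimensional _).measurable
  rw [charFun_apply, integral_map hM.aemeasurable (by fun_prop)]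
  simp only [inner_toEuclideanLin_left]
  rw [← charFun_apply, charFun_multivariateGaussian hS]
  congr 1
  simp only [inner_zero_right, Complex.ofReal_zero, zero_mul, zero_sub, neg_div]
  congr 3
  simp only [Matrix.ofLp_toLpLin, Matrix.toLin'_apply]
  rw [← Matrix.mulVec_mulVec, ← Matrix.mulVec_mulVec, Matrix.dotProduct_mulVec _ M,
    ← Matrix.mulVec_transpose]

theorem gaussian_mean_eq_map {n : ℕ} (μ : Vec n) (S : Mat n n) :
    multivariateGaussian μ S = (multivariateGaussian 0 S).map (fun w => μ + w) := by
  rw [multivariateGaussian, multivariateGaussian, Measure.map_map (by fun_prop) (by fun_prop)]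
  congr 1
  funext x
  simp

theorem measurable_toEuclideanLin {n m : ℕ} (M : Mat n m) :
    Measurable fun x : Vec m => M.toEuclideanLin x :=
  (LinearMap.continuous_of_finiteDimensional _).measurable

theorem step_apply {n m : ℕ} (A : Mat n n) (B : Mat n m) (π : Kernel (Vec n) (Vec m))
    [IsSFiniteKernel π] (x : Vec n) :
    step A B π x = (π x).map fun u => A.toEuclideanLin x + B.toEuclideanLin u := by
  have hA := measurable_toEuclideanLin A
  have hB := measurable_toEuclideanLin B
  have hf : Measurable fun p : Vec n × Vec m => A.toEuclideanLin p.1 + B.toEuclideanLin p.2 :=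
    (hA.comp measurable_fst).add (hB.comp measurable_snd)
  rw [step, Kernel.map_apply _ hf, Kernel.prod_apply, Kernel.id_apply, Measure.dirac_prod,
    Measure.map_map hf (by fun_prop)]
  rfl

instance {n m : ℕ} (K : Mat m n) (S : Mat m m) : IsMarkovKernel (gaussianPolicy K S) :=
  ⟨fun x => inferInstanceAs (IsProbabilityMeasure (multivariateGaussian (K.toEuclideanLin x) S))⟩

instance {n m : ℕ} (A : Mat n n) (B : Mat n m) (π : Kernel (Vec n) (Vec m))
    [IsMarkovKernel π] : IsMarkovKernel (step A B π) := by
  have hA := measurable_toEuclideanLin A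
  have hB := measurable_toEuclideanLin B
  exact Kernel.IsMarkovKernel.map _ ((hA.comp measurable_fst).add (hB.comp measurable_snd))

/-- The next state is `(A + B K) x + B w` with `w` independent of `x`, so its law is a convolution.
Characteristic functions are used because `B S Bᵀ` may be singular. -/
theorem gaussian_bind_step {n m : ℕ} (A C₀ : Mat n n) (B : Mat n m) (K : Mat m n) (S : Mat m m)
    (hC₀ : C₀.PosSemidef) (hS : S.PosSemidef) :
    (multivariateGaussian 0 C₀).bind (step A B (gaussianPolicy K S)) =
      multivariateGaussian 0 ((A + B * K) * C₀ * (A + B * K)ᵀ + B * S * Bᵀ) := by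
  have hC := measurable_toEuclideanLin (A + B * K)
  have hA := measurable_toEuclideanLin A
  have hB := measurable_toEuclideanLin B
  have hf : Measurable fun p : Vec n × Vec m =>
      (A + B * K).toEuclideanLin p.1 + B.toEuclideanLin p.2 :=
    (hC.comp measurable_fst).add (hB.comp measurable_snd)
  have h1 : (multivariateGaussian 0 C₀).bind (step A B (gaussianPolicy K S)) =
      ((multivariateGaussian 0 C₀).map fun x => (A + B * K).toEuclideanLin x) ∗
        ((multivariateGaussian 0 S).map fun x => B.toEuclideanLin x) := by
    rw [Measure.conv, Measure.map_prod_map _ _ hC hB, Measure.map_map (by fun_prop) (by fun_prop)]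
    ext s hs
    rw [Measure.bind_apply hs (Kernel.aemeasurable _), Measure.map_apply (by fun_prop) hs,
      Measure.prod_apply (by exact hf hs)]
    refine lintegral_congr fun x => ?_
    have h2 : gaussianPolicy K S x = multivariateGaussian (K.toEuclideanLin x) S := rfl
    rw [step_apply, h2, gaussian_mean_eq_map, Measure.map_map (by fun_prop) (by fun_prop),
      Measure.map_apply (by fun_prop) hs]
    congr 1
    ext w
    have h3 : A.toEuclideanLin x + B.toEuclideanLin (K.toEuclideanLin x + w)
        = (A + B * K).toEuclideanLin x + B.toEuclideanLin w := by
      rw [map_add, ← add_assoc]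
      congr 1
      ext i
      simp [Matrix.mulVec_mulVec, Matrix.toLpLin_apply]
    simp only [Set.mem_preimage, Function.comp_apply, h3, Prod.map]
  have : IsProbabilityMeasure ((multivariateGaussian 0 C₀).map
      fun x => (A + B * K).toEuclideanLin x) := Measure.isProbabilityMeasure_map hC.aemeasurable
  have : IsProbabilityMeasure ((multivariateGaussian 0 S).map
      fun x => B.toEuclideanLin x) := Measure.isProbabilityMeasure_map hB.aemeasurable
  rw [h1]
  apply Measure.ext_of_charFun
  funext t
  rw [charFun_conv, charFun_map_gaussian _ hC₀, charFun_map_gaussian _ hS,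
    charFun_multivariateGaussian ((posSemidef_conj hC₀ _).add (posSemidef_conj hS _)),
    ← Complex.exp_add]
  congr 1
  rw [Matrix.add_mulVec, dotProduct_add]
  simp only [inner_zero_right, Complex.ofReal_zero, zero_mul, zero_sub]
  push_cast; ring

/-! ### The transition densities of the controlled process -/

/-- Completion of the square for the feedback policy. -/
theorem sqNorm_feedback {n m : ℕ} {A Q Q' : Mat n n} {B : Mat n m} {D P : Mat m m}
    (hA : IsUnit A) (hQ' : IsUnit Q') (hQt' : Q'ᵀ = Q')
    (hD : IsUnit D) (h : Q' = A * Q * Aᵀ - B * D⁻¹ * Bᵀ) (hPd : P = D + Bᵀ * Q'⁻¹ * B)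
    (hP : P.PosDef) (x : Vec n) (u : Vec m) :
    sqNorm P (u - (-(P⁻¹ * Bᵀ * Q'⁻¹ * A)).toEuclideanLin x) =
      sqNorm D u + sqNorm Q'⁻¹ (A.toEuclideanLin x + B.toEuclideanLin u) - sqNorm Q⁻¹ x := by
  have hwb := woodbury_inv hQ' hD h (hPd ▸ hP.isUnit)
  rw [← hPd, Matrix.mul_inv_rev, Matrix.mul_inv_rev] at hwb
  have hAi : Aᵀ * Aᵀ⁻¹ = 1 := mul_inv_of_isUnit ((Matrix.isUnit_transpose _).2 hA)
  have hQi : Q⁻¹ = Aᵀ * (Q'⁻¹ - Q'⁻¹ * B * P⁻¹ * Bᵀ * Q'⁻¹) * A := by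
    rw [← hwb, ← mul_assoc, hAi, one_mul, mul_assoc, inv_mul_of_isUnit hA, mul_one]
  have hQit : (Q'⁻¹)ᵀ = Q'⁻¹ := by rw [Matrix.transpose_nonsing_inv, hQt']
  simp only [sqNorm, WithLp.ofLp_sub, WithLp.ofLp_add, Matrix.ofLp_toLpLin, Matrix.toLin'_apply]
  set y := x.ofLp
  set v := u.ofLp
  have sym : ∀ {k l : ℕ} (M : Mat k l) (a : Fin k → ℝ) (b : Fin l → ℝ),
      a ⬝ᵥ M *ᵥ b = b ⬝ᵥ Mᵀ *ᵥ a := fun M a b => by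
    rw [Matrix.dotProduct_mulVec, ← Matrix.mulVec_transpose, dotProduct_comm]
  -- The coefficient of the terms linear in `u`; the policy mean is `-P⁻¹ z`, the point that
  -- completes the square.
  set z := Bᵀ *ᵥ Q'⁻¹ *ᵥ A *ᵥ y with hz
  have e1 : v - (-(P⁻¹ * Bᵀ * Q'⁻¹ * A)) *ᵥ y = v + P⁻¹ *ᵥ z := by
    rw [Matrix.neg_mulVec, sub_neg_eq_add, hz]
    simp only [Matrix.mulVec_mulVec, Matrix.mul_assoc]
  have e2 : P *ᵥ P⁻¹ *ᵥ z = z := by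
    rw [Matrix.mulVec_mulVec, mul_inv_of_isUnit hP.isUnit, Matrix.one_mulVec]
  have e3 : (P⁻¹ *ᵥ z) ⬝ᵥ P *ᵥ v = v ⬝ᵥ z := by
    rw [sym, hP.transpose_eq, e2]
  have e4 : v ⬝ᵥ P *ᵥ v = v ⬝ᵥ D *ᵥ v + (B *ᵥ v) ⬝ᵥ Q'⁻¹ *ᵥ B *ᵥ v := by
    rw [hPd, Matrix.add_mulVec, dotProduct_add, ← Matrix.mulVec_mulVec, ← Matrix.mulVec_mulVec,
      sym Bᵀ, Matrix.transpose_transpose, dotProduct_comm (_ *ᵥ _ *ᵥ _)]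
  have e5 : v ⬝ᵥ z = (B *ᵥ v) ⬝ᵥ Q'⁻¹ *ᵥ A *ᵥ y := by
    rw [hz, sym Bᵀ, Matrix.transpose_transpose, dotProduct_comm]
  have e6 : (A *ᵥ y) ⬝ᵥ Q'⁻¹ *ᵥ B *ᵥ v = v ⬝ᵥ z := by
    rw [sym, hQit, e5]
  have e7 : y ⬝ᵥ Q⁻¹ *ᵥ y = (A *ᵥ y) ⬝ᵥ Q'⁻¹ *ᵥ A *ᵥ y - z ⬝ᵥ P⁻¹ *ᵥ z := by
    have e8 : z ⬝ᵥ P⁻¹ *ᵥ z = (A *ᵥ y) ⬝ᵥ (Q'⁻¹ * B * P⁻¹ * Bᵀ * Q'⁻¹) *ᵥ A *ᵥ y := by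
      rw [dotProduct_comm, hz, sym Bᵀ, dotProduct_comm (Q'⁻¹ *ᵥ A *ᵥ y),
        sym Q'⁻¹, hQit, Matrix.transpose_transpose]
      simp only [Matrix.mulVec_mulVec, Matrix.mul_assoc]
    rw [hQi, ← Matrix.mulVec_mulVec, ← Matrix.mulVec_mulVec, sym Aᵀ, Matrix.transpose_transpose,
      dotProduct_comm, e8, ← dotProduct_sub, ← Matrix.sub_mulVec]
  rw [e1, e7]
  simp only [Matrix.mulVec_add, dotProduct_add, add_dotProduct, e2, e3, e4, e6, ← e5]
  rw [dotProduct_comm (P⁻¹ *ᵥ z) z]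
  ring

theorem pinv_mul_self_of_rank {n m : ℕ} {B : Mat n m} (h : B.rank = m) : pinv B * B = 1 := by
  have h1 := (penrose B).1
  have h2 := mulVec_injective_of_rank h
  refine Matrix.toLin'.injective (LinearMap.ext fun v => h2 ?_)
  simp only [Matrix.toLin'_apply, Matrix.mulVec_mulVec, Matrix.one_mulVec, ← Matrix.mul_assoc, h1]

/-- Full column rank makes the pseudoinverse a left inverse, so the potential measures the energy of
the input. -/
theorem sqNorm_pinv {n m : ℕ} {B : Mat n m} (h : B.rank = m) (u : Vec m) :
    sqNorm ((pinv B)ᵀ * pinv B) (B.toEuclideanLin u) = sqNorm 1 u := by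
  simp only [sqNorm, Matrix.ofLp_toLpLin, Matrix.toLin'_apply, Matrix.mulVec_mulVec]
  rw [Matrix.mul_assoc, pinv_mul_self_of_rank h, Matrix.mul_one, Matrix.dotProduct_mulVec,
    ← Matrix.mulVec_transpose, Matrix.mulVec_mulVec, Matrix.transpose_transpose,
    pinv_mul_self_of_rank h, Matrix.one_mulVec]

/-- The ratio of the two input laws at `u` depends on `u` only through `y = A x + B u`, so it passes
to the laws of `y`. The constant involves only covariances and is the same for all `x`. -/
theorem exists_step_density {n m : ℕ} {A Q Q' : Mat n n} {B : Mat n m} {S P : Mat m m}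
    (hA : IsUnit A) (hQ' : IsUnit Q') (hQt' : Q'ᵀ = Q') (hS : S.PosDef)
    (h : Q' = A * Q * Aᵀ - B * (S⁻¹ + 1)⁻¹ * Bᵀ) (hPd : P = S⁻¹ + 1 + Bᵀ * Q'⁻¹ * B)
    (hP : P.PosDef) (hB : B.rank = m) :
    ∃ c : ℝ, ∀ x : Vec n, step A B (gaussianPolicy (-(P⁻¹ * Bᵀ * Q'⁻¹ * A)) P⁻¹) x =
      (step A B (Kernel.const (Vec n) (multivariateGaussian 0 S)) x).withDensity fun y =>
        ENNReal.ofReal (Real.exp (c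
          - 1 / 2 * sqNorm ((pinv B)ᵀ * pinv B) (y - A.toEuclideanLin x)
          + (1 / 2 * sqNorm Q⁻¹ x - 1 / 2 * sqNorm Q'⁻¹ y))) := by
  obtain ⟨c, hc⟩ := exists_gaussian_withDensity hP.inv hS
  refine ⟨c, fun x => ?_⟩
  have hB' := measurable_toEuclideanLin B
  have h1 := measurable_sqNorm ((pinv B)ᵀ * pinv B)
  have h2 := measurable_sqNorm Q'⁻¹
  have hD : (S⁻¹ + 1).PosDef := hS.inv.add Matrix.PosDef.one
  rw [step_apply, step_apply, ← map_withDensity_comp _ (by fun_prop) (by fun_prop),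
    Kernel.const_apply]
  have h3 : ∀ K : Mat m n, gaussianPolicy K P⁻¹ x = multivariateGaussian (K.toEuclideanLin x) P⁻¹ :=
    fun _ => rfl
  rw [h3, hc _ 0]
  congr 2
  funext u
  rw [Matrix.nonsing_inv_nonsing_inv _ ((Matrix.isUnit_iff_isUnit_det _).1 hP.isUnit),
    sqNorm_feedback hA hQ' hQt' hD.isUnit h hPd hP, add_sub_cancel_left, sqNorm_pinv hB, sub_zero]
  have h4 : sqNorm (S⁻¹ + 1) u = sqNorm S⁻¹ u + sqNorm 1 u := by
    simp only [sqNorm, Matrix.add_mulVec, dotProduct_add]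
  rw [h4]
  congr 2
  ring

/-! ### Densities and marginals of process laws -/

instance {n m : ℕ} (A : ℕ → Mat n n) (B : ℕ → Mat n m) (μ₀ : Measure (Vec n))
    [IsProbabilityMeasure μ₀] (π : ℕ → Kernel (Vec n) (Vec m)) [∀ k, IsMarkovKernel (π k)] (T : ℕ) :
    IsProbabilityMeasure (processLaw A B μ₀ π T) := by
  induction T with
  | zero => exact Measure.isProbabilityMeasure_map (by fun_prop)
  | succ T ih =>
    rw [processLaw]
    exact Measure.isProbabilityMeasure_map (by fun_prop)

theorem measurable_snoc (n T : ℕ) : Measurable fun p : (Fin (T + 1) → Vec n) × Vec n =>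
    (Fin.snoc p.1 p.2 : Fin (T + 2) → Vec n) := by
  refine measurable_pi_iff.2 fun i => ?_
  refine Fin.lastCases ?_ (fun j => ?_) i
  · simpa using measurable_snd
  · simp only [Fin.snoc_castSucc]
    fun_prop

theorem compProd_withDensity_both {α β : Type*} [MeasurableSpace α] [MeasurableSpace β]
    {μ : Measure α} [SFinite μ] {κ κ' : Kernel α β} [IsSFiniteKernel κ] [IsSFiniteKernel κ']
    {f : α → ℝ≥0∞} {g : α → β → ℝ≥0∞} [SFinite (μ.withDensity f)] (hf : Measurable f)
    (hg : Measurable (Function.uncurry g))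
    (h : ∀ a, κ a = (κ' a).withDensity (g a)) :
    (μ.withDensity f) ⊗ₘ κ = (μ ⊗ₘ κ').withDensity fun p => f p.1 * g p.1 p.2 := by
  ext s hs
  rw [Measure.compProd_apply hs, withDensity_apply _ hs, ← lintegral_indicator hs,
    Measure.lintegral_compProd ((by fun_prop : Measurable fun p : α × β => f p.1 * g p.1 p.2).indicator hs),
    lintegral_withDensity_eq_lintegral_mul _ hf (Kernel.measurable_kernel_prodMk_left hs)]
  refine lintegral_congr fun a => ?_
  rw [Pi.mul_apply, h a, withDensity_apply _ (measurable_prodMk_left hs),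
    ← lintegral_indicator (measurable_prodMk_left hs), ← lintegral_const_mul]
  · refine lintegral_congr fun b => ?_
    by_cases hb : (a, b) ∈ s <;> simp [Set.indicator, hb]
  · exact (hg.comp measurable_prodMk_left).indicator (measurable_prodMk_left hs)

theorem processLaw_withDensity {n m : ℕ} {A : ℕ → Mat n n} {B : ℕ → Mat n m}
    {μ₀ ν₀ : Measure (Vec n)} [IsProbabilityMeasure μ₀] [IsProbabilityMeasure ν₀]
    {π η : ℕ → Kernel (Vec n) (Vec m)} [∀ k, IsMarkovKernel (π k)] [∀ k, IsMarkovKernel (η k)]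
    {a : Vec n → ℝ} {ψ : ℕ → Vec n → Vec n → ℝ} (ha : Measurable a)
    (hψ : ∀ k, Measurable (Function.uncurry (ψ k)))
    (h0 : μ₀ = ν₀.withDensity fun x => ENNReal.ofReal (Real.exp (a x))) (T : ℕ)
    (h : ∀ k < T, ∀ x, step (A k) (B k) (π k) x = (step (A k) (B k) (η k) x).withDensity
      fun y => ENNReal.ofReal (Real.exp (ψ k x y))) :
    processLaw A B μ₀ π T = (processLaw A B ν₀ η T).withDensity fun x =>
      ENNReal.ofReal (Real.exp (a (x 0) + ∑ k : Fin T, ψ k (x k.castSucc) (x k.succ))) := by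
  have hmeas : ∀ T : ℕ, Measurable fun x : Fin (T + 1) → Vec n =>
      ENNReal.ofReal (Real.exp (a (x 0) + ∑ k : Fin T, ψ k (x k.castSucc) (x k.succ))) := by
    intro T
    refine (Real.measurable_exp.comp (Measurable.add (by fun_prop) ?_)).ennreal_ofReal
    refine Finset.measurable_fun_sum _ fun k _ => ?_
    have hp : Measurable fun x : Fin (T + 1) → Vec n => (x k.castSucc, x k.succ) := by fun_prop
    exact (hψ k).comp hp
  induction T with
  | zero =>
    rw [processLaw, processLaw, h0, ← map_withDensity_comp _ (by fun_prop) (hmeas 0)]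
    simp
  | succ T ih =>
    have ih := ih fun k hk => h k (by omega)
    rw [processLaw, processLaw, ← map_withDensity_comp _ (measurable_snoc n T) (hmeas (T + 1))]
    congr 1
    -- Supplies the s-finiteness that the composition product requires of the weighted measure.
    have hp : IsProbabilityMeasure ((processLaw A B ν₀ η T).withDensity fun x =>
        ENNReal.ofReal (Real.exp (a (x 0) + ∑ k : Fin T, ψ k (x k.castSucc) (x k.succ)))) := by
      rw [← ih]; infer_instance
    rw [ih, compProd_withDensity_both (g := fun x y =>
      ENNReal.ofReal (Real.exp (ψ T (x (Fin.last T)) y))) (hmeas T) ?_ ?_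
      (κ' := (step (A T) (B T) (η T)).comap (fun x : Fin (T + 1) → Vec n => x (Fin.last T))
          (measurable_pi_apply _))]
    · congr 1
      funext p
      rw [← ENNReal.ofReal_mul (Real.exp_pos _).le, ← Real.exp_add, Fin.sum_univ_castSucc]
      congr 2
      have e0 : (Fin.snoc p.1 p.2 : Fin (T + 2) → Vec n) 0 = p.1 0 :=
        Fin.snoc_castSucc (α := fun _ => Vec n) p.2 p.1 0
      simp only [e0, Fin.succ_castSucc, Fin.snoc_castSucc, Fin.val_castSucc, Fin.val_last,
        Fin.succ_last, Fin.snoc_last]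
      ring
    · have hq : Measurable fun p : (Fin (T + 1) → Vec n) × Vec n => (p.1 (Fin.last T), p.2) := by
        fun_prop
      exact ((hψ T).comp hq).exp.ennreal_ofReal
    · intro x
      rw [Kernel.comap_apply, Kernel.comap_apply, h T (by omega)]

theorem processLaw_map_zero {n m : ℕ} (A : ℕ → Mat n n) (B : ℕ → Mat n m) (μ₀ : Measure (Vec n))
    [IsProbabilityMeasure μ₀] (π : ℕ → Kernel (Vec n) (Vec m)) [∀ k, IsMarkovKernel (π k)] (T : ℕ) :
    (processLaw A B μ₀ π T).map (fun x => x 0) = μ₀ := by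
  induction T with
  | zero =>
    rw [processLaw, Measure.map_map (by fun_prop) (by fun_prop)]
    exact Measure.map_id
  | succ T ih =>
    rw [processLaw, Measure.map_map (by fun_prop) (measurable_snoc n T)]
    have e : ((fun x : Fin (T + 2) → Vec n => x 0) ∘ fun p : (Fin (T + 1) → Vec n) × Vec n =>
        (Fin.snoc p.1 p.2 : Fin (T + 2) → Vec n)) = (fun x : Fin (T + 1) → Vec n => x 0) ∘ Prod.fst := by
      funext p
      exact Fin.snoc_castSucc (α := fun _ => Vec n) p.2 p.1 0
    rw [e, ← Measure.map_map (by fun_prop) (by fun_prop)]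
    have := Measure.fst_compProd (processLaw A B μ₀ π T) ((step (A T) (B T) (π T)).comap
      (fun x : Fin (T + 1) → Vec n => x (Fin.last T)) (measurable_pi_apply _))
    rw [Measure.fst] at this
    rw [this, ih]

theorem processLaw_map_last_succ {n m : ℕ} (A : ℕ → Mat n n) (B : ℕ → Mat n m)
    (μ₀ : Measure (Vec n)) [IsProbabilityMeasure μ₀] (π : ℕ → Kernel (Vec n) (Vec m))
    [∀ k, IsMarkovKernel (π k)] (T : ℕ) :
    (processLaw A B μ₀ π (T + 1)).map (fun x => x (Fin.last (T + 1))) =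
      ((processLaw A B μ₀ π T).map fun x => x (Fin.last T)).bind (step (A T) (B T) (π T)) := by
  rw [processLaw, Measure.map_map (by fun_prop) (measurable_snoc n T)]
  have e : ((fun x : Fin (T + 2) → Vec n => x (Fin.last (T + 1))) ∘
      fun p : (Fin (T + 1) → Vec n) × Vec n => (Fin.snoc p.1 p.2 : Fin (T + 2) → Vec n))
      = Prod.snd := by
    funext p
    simp
  have h := Measure.snd_compProd (processLaw A B μ₀ π T) ((step (A T) (B T) (π T)).comap
    (fun x : Fin (T + 1) → Vec n => x (Fin.last T)) (measurable_pi_apply _))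
  rw [Measure.snd] at h
  rw [e, h]
  ext s hs
  rw [Measure.bind_apply hs (Kernel.aemeasurable _), Measure.bind_apply hs (Kernel.aemeasurable _),
    lintegral_map (Kernel.measurable_coe _ hs) (by fun_prop)]
  rfl

theorem processLaw_map_last {n m : ℕ} (A : ℕ → Mat n n) (B : ℕ → Mat n m) (K : ℕ → Mat m n)
    (S : ℕ → Mat m m) {Sini : Mat n n} (hini : Sini.PosSemidef) (T : ℕ)
    (hS : ∀ k < T, (S k).PosSemidef) :
    (processLaw A B (multivariateGaussian 0 Sini) (fun k => gaussianPolicy (K k) (S k)) T).map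
      (fun x => x (Fin.last T)) = multivariateGaussian 0 (stateCov A B K S Sini T) := by
  induction T with
  | zero =>
    rw [processLaw, Measure.map_map (by fun_prop) (by fun_prop)]
    exact Measure.map_id
  | succ T ih =>
    have hS' : ∀ k < T, (S k).PosSemidef := fun k hk => hS k (by omega)
    rw [processLaw_map_last_succ, ih hS', gaussian_bind_step _ _ _ _ _
      (stateCov_posSemidef hini hS') (hS T (by omega))]
    rfl

/-! ### The Gibbs variational principle -/

section Gibbs

open InformationTheory

variable {α : Type*} [MeasurableSpace α] {Q ν : Measure α} {f V : α → ℝ}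

theorem integral_exp_eq_one_of_withDensity [IsProbabilityMeasure ν] {φ : α → ℝ} (hφ : Measurable φ)
    (hν : ν = Q.withDensity fun x => ENNReal.ofReal (Real.exp (φ x))) :
    Integrable (fun x => Real.exp (φ x)) Q ∧ ∫ x, Real.exp (φ x) ∂Q = 1 := by
  have h1 : ∫⁻ x, ENNReal.ofReal (Real.exp (φ x)) ∂Q = 1 := by
    rw [← setLIntegral_univ, ← withDensity_apply _ MeasurableSet.univ, ← hν, measure_univ]
  have h2 : Integrable (fun x => Real.exp (φ x)) Q := by
    refine ⟨by fun_prop, ?_⟩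
    rw [hasFiniteIntegral_iff_ofReal (by filter_upwards with x using (Real.exp_pos _).le), h1]
    exact ENNReal.one_lt_top
  refine ⟨h2, ?_⟩
  rw [integral_eq_lintegral_of_nonneg_ae (by filter_upwards with x using (Real.exp_pos _).le)
    (by fun_prop), h1, ENNReal.toReal_one]

theorem eq_tilted_of_withDensity [IsProbabilityMeasure ν] {φ : α → ℝ} (hφ : Measurable φ)
    (hν : ν = Q.withDensity fun x => ENNReal.ofReal (Real.exp (φ x))) : ν = Q.tilted φ := by
  rw [Measure.tilted, (integral_exp_eq_one_of_withDensity hφ hν).2]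
  simpa using hν

variable [IsProbabilityMeasure Q]

/-- The potential is integrable under the Gibbs measure. -/
theorem integrable_potential_of_withDensity (hf : Measurable f) (hV : Measurable V)
    (hV0 : ∀ x, 0 ≤ V x)
    (hν : ν = Q.withDensity fun x => ENNReal.ofReal (Real.exp (f x - V x)))
    (hfν : Integrable f ν) : Integrable V ν := by
  -- For any log-density `t`, the inequality `1 - t ≤ exp (-t)` gives `exp t * (-t) ≤ 1`. Afterwards
  -- `V = f - t` is bounded by `|f|` plus the negative part of `t`.
  have h1 : ∫⁻ x, ENNReal.ofReal (-(f x - V x)) ∂ν ≤ 1 := by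
    rw [hν, lintegral_withDensity_eq_lintegral_mul _ (by fun_prop) (by fun_prop)]
    calc _ ≤ ∫⁻ _, 1 ∂Q := by
          refine lintegral_mono fun x => ?_
          rw [Pi.mul_apply, ← ENNReal.ofReal_mul (Real.exp_pos _).le, ← ENNReal.ofReal_one]
          refine ENNReal.ofReal_le_ofReal ?_
          set t := f x - V x
          have h2 := Real.add_one_le_exp (-t)
          have h3 : Real.exp t * Real.exp (-t) = 1 := by rw [← Real.exp_add]; simp
          nlinarith [Real.exp_pos t]
      _ = 1 := by simp
  refine ⟨hV.aestronglyMeasurable, ?_⟩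
  rw [hasFiniteIntegral_iff_ofReal (by filter_upwards with x using hV0 x)]
  calc ∫⁻ x, ENNReal.ofReal (V x) ∂ν
      ≤ ∫⁻ x, (ENNReal.ofReal |f x| + ENNReal.ofReal (-(f x - V x))) ∂ν := by
        refine lintegral_mono fun x => ?_
        refine le_trans (ENNReal.ofReal_le_ofReal ?_) ENNReal.ofReal_add_le
        linarith [le_abs_self (f x)]
    _ = ∫⁻ x, ENNReal.ofReal |f x| ∂ν + ∫⁻ x, ENNReal.ofReal (-(f x - V x)) ∂ν :=
        lintegral_add_left (by fun_prop) _
    _ < ⊤ := by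
        refine ENNReal.add_lt_top.2 ⟨?_, h1.trans_lt ENNReal.one_lt_top⟩
        exact (hasFiniteIntegral_iff_ofReal (by filter_upwards with x using abs_nonneg _)).1
          hfν.abs.2

variable [IsProbabilityMeasure ν]

theorem klDiv_eq_ofReal_integral {P S : Measure α} [IsProbabilityMeasure P]
    [IsProbabilityMeasure S] (h1 : P ≪ S) (h2 : Integrable (llr P S) P) :
    klDiv P S = ENNReal.ofReal (∫ x, llr P S x ∂P) ∧ 0 ≤ ∫ x, llr P S x ∂P := by
  have h3 := klDiv_of_ac_of_integrable h1 h2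
  have h4 := integral_llr_add_sub_measure_univ_nonneg h1 h2
  simp only [probReal_univ, add_sub_cancel_right] at h3 h4
  exact ⟨h3, h4⟩

/-- The log-density of `ν` is `f - V`, so the mean of `V` cancels; its integrability is what makes
the cancellation legitimate. -/
theorem klDiv_add_potential_eq (hf : Measurable f) (hV : Measurable V)
    (hV0 : ∀ x, 0 ≤ V x)
    (hν : ν = Q.withDensity fun x => ENNReal.ofReal (Real.exp (f x - V x)))
    (hfν : Integrable f ν) :
    klDiv ν Q + ∫⁻ x, ENNReal.ofReal (V x) ∂ν = ENNReal.ofReal (∫ x, f x ∂ν) ∧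
      0 ≤ ∫ x, f x ∂ν := by
  have hVν := integrable_potential_of_withDensity hf hV hV0 hν hfν
  have ht := eq_tilted_of_withDensity (hf.sub hV) hν
  obtain ⟨hi, hi1⟩ := integral_exp_eq_one_of_withDensity (hf.sub hV) hν
  have hac : ν ≪ Q := by rw [hν]; exact withDensity_absolutelyContinuous _ _
  have hllr : llr ν Q =ᵐ[ν] fun x => f x - V x := by
    refine hac.ae_le ?_
    have := log_rnDeriv_tilted_left_self hi
    rw [← ht, hi1, Real.log_one] at this
    filter_upwards [this] with x hx
    simpa [llr] using hx
  have hint : Integrable (llr ν Q) ν := (integrable_congr hllr).2 (hfν.sub hVν)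
  obtain ⟨h1, h2⟩ := klDiv_eq_ofReal_integral hac hint
  have h3 : ∫ x, llr ν Q x ∂ν + ∫ x, V x ∂ν = ∫ x, f x ∂ν := by
    rw [integral_congr_ae hllr, integral_sub hfν hVν, sub_add_cancel]
  rw [h1, ← ofReal_integral_eq_lintegral_ofReal hVν (by filter_upwards with x using hV0 x),
    ← ENNReal.ofReal_add h2 (integral_nonneg hV0), h3]
  exact ⟨rfl, h3 ▸ add_nonneg h2 (integral_nonneg hV0)⟩

/-- Integrate `log dP/dν = log dP/dQ - (f - V)` under `P`; the mean of `f` is common to `P` and `ν`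
and equals the cost of `ν`. Stating only the inequality makes the case of infinite cost trivial. -/
theorem klDiv_add_le_klDiv_add_potential (hf : Measurable f) (hV : Measurable V)
    (hV0 : ∀ x, 0 ≤ V x)
    (hν : ν = Q.withDensity fun x => ENNReal.ofReal (Real.exp (f x - V x)))
    (hfν : Integrable f ν) {P : Measure α} [IsProbabilityMeasure P] (hfP : Integrable f P)
    (heq : ∫ x, f x ∂P = ∫ x, f x ∂ν) :
    klDiv P ν + (klDiv ν Q + ∫⁻ x, ENNReal.ofReal (V x) ∂ν) ≤
      klDiv P Q + ∫⁻ x, ENNReal.ofReal (V x) ∂P := by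
  by_cases htop : klDiv P Q + ∫⁻ x, ENNReal.ofReal (V x) ∂P = ⊤
  · rw [htop]; exact le_top
  obtain ⟨hk, hl⟩ := ENNReal.add_ne_top.1 htop
  obtain ⟨hac, hint⟩ := klDiv_ne_top_iff.1 hk
  have hVP : Integrable V P := by
    refine ⟨hV.aestronglyMeasurable, ?_⟩
    rw [hasFiniteIntegral_iff_ofReal (by filter_upwards with x using hV0 x)]
    exact hl.lt_top
  have ht := eq_tilted_of_withDensity (hf.sub hV) hν
  obtain ⟨hi, hi1⟩ := integral_exp_eq_one_of_withDensity (hf.sub hV) hν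
  have hllr : llr P ν =ᵐ[P] fun x => -(f x - V x) + llr P Q x := by
    have := llr_tilted_right hac hi
    rw [← ht, hi1, Real.log_one] at this
    simpa using this
  have hacR : P ≪ ν := by rw [ht]; exact hac.trans (absolutelyContinuous_tilted hi)
  have hintR : Integrable (llr P ν) P :=
    (integrable_congr hllr).2 ((hfP.sub hVP).neg.add hint)
  obtain ⟨h1, h2⟩ := klDiv_eq_ofReal_integral hac hint
  obtain ⟨h3, h4⟩ := klDiv_eq_ofReal_integral hacR hintR
  have h5 : ∫ x, llr P ν x ∂P = -(∫ x, f x ∂P - ∫ x, V x ∂P) + ∫ x, llr P Q x ∂P := by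
    have hg : Integrable (fun x => -(f x - V x)) P := (hfP.sub hVP).neg
    rw [integral_congr_ae hllr, integral_add hg hint, integral_neg,
      integral_sub hfP hVP]
  obtain ⟨hJ, hJ0⟩ := klDiv_add_potential_eq hf hV hV0 hν hfν
  rw [hJ, h1, h3, ← ofReal_integral_eq_lintegral_ofReal hVP (by filter_upwards with x using hV0 x),
    ← ENNReal.ofReal_add h2 (integral_nonneg hV0), ← ENNReal.ofReal_add h4 hJ0, h5, heq]
  refine ENNReal.ofReal_le_ofReal ?_
  linarith

end Gibbs

/-! ### Endpoint functionals -/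

theorem integrable_sqNorm_gaussian {n : ℕ} (M S : Mat n n) (μ ν : Vec n) :
    Integrable (fun x => sqNorm M (x - μ)) (multivariateGaussian ν S) := by
  have h0 : MemLp (fun x : Vec n => x - μ) 2 (multivariateGaussian ν S) :=
    IsGaussian.memLp_two_id.sub (memLp_const μ)
  have h1 : ∀ i, MemLp (fun x : Vec n => (x - μ).ofLp i) 2 (multivariateGaussian ν S) := fun i =>
    ((EuclideanSpace.proj (𝕜 := ℝ) i).comp_memLp' h0 :)
  simp only [sqNorm, dotProduct, Matrix.mulVec, Finset.mul_sum]
  refine integrable_finsetSum _ fun i _ => integrable_finsetSum _ fun j _ => ?_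
  have := ((h1 i).integrable_mul (h1 j)).const_mul (M i j)
  refine this.congr (Filter.Eventually.of_forall fun x => ?_)
  simp only [Pi.mul_apply]; ring

theorem sum_castSucc_sub_succ {T : ℕ} (h : Fin (T + 1) → ℝ) :
    ∑ k : Fin T, (h k.castSucc - h k.succ) = h 0 - h (Fin.last T) := by
  induction T with
  | zero => simp
  | succ T ih =>
    rw [Fin.sum_univ_castSucc]
    have := ih fun i => h i.castSucc
    simp only [Fin.succ_castSucc, Fin.succ_last, Fin.castSucc_zero] at this ⊢
    rw [this]; ring

theorem sqNorm_transpose_mul_self_nonneg {n m : ℕ} (M : Mat m n) (x : Vec n) :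
    0 ≤ sqNorm (Mᵀ * M) x := by
  have := (Matrix.posSemidef_conjTranspose_mul_self M).dotProduct_mulVec_nonneg x.ofLp
  simpa [sqNorm] using this

theorem potential_nonneg {n m : ℕ} (T : ℕ) (A : ℕ → Mat n n) (B : ℕ → Mat n m)
    (x : Fin (T + 1) → Vec n) : 0 ≤ potential T A B x :=
  Finset.sum_nonneg fun _ _ => mul_nonneg (by norm_num) (sqNorm_transpose_mul_self_nonneg _ _)

theorem measurable_potential {n m : ℕ} (T : ℕ) (A : ℕ → Mat n n) (B : ℕ → Mat n m) :
    Measurable (potential T A B) := by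
  refine Finset.measurable_fun_sum _ fun k _ => Measurable.const_mul ?_ _
  refine (measurable_sqNorm _).comp ?_
  exact (measurable_pi_apply _).sub ((measurable_toEuclideanLin _).comp (measurable_pi_apply _))

/-- The Gibbs form of the controlled law relative to the reference law. -/
theorem exists_controlledLaw_withDensity {n m T : ℕ} {A : ℕ → Mat n n} {B : ℕ → Mat n m}
    {Srho : ℕ → Mat m m} {Sini Sfin W : Mat n n} (hSini : Sini.PosDef) (μref : Vec n)
    {Sref : Mat n n} (hSref : Sref.PosDef) (hSrho : ∀ k < T, (Srho k).PosDef)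
    (h : LyapData T A B Srho Sini Sfin W) (hA : ∀ k < T, IsUnit (A k))
    (hB : ∀ k < T, (B k).rank = m)
    (hQ : ∀ k ≤ T, IsUnit (lyap T A (inputRho B Srho) Sini Sfin k))
    (hP : ∀ k < T, (precision T A B Srho Sini Sfin k).PosDef) :
    ∃ a b : Vec n → ℝ, Measurable a ∧ Measurable b ∧
      (∀ S, Integrable a (multivariateGaussian 0 S)) ∧
      (∀ S, Integrable b (multivariateGaussian 0 S)) ∧
      controlledLaw T A B Sini (policyRho T A B Srho Sini Sfin) =
      (referenceLaw T A B Srho μref Sref).withDensity fun x => ENNReal.ofReal (Real.exp (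
        (a (x 0) + b (x (Fin.last T))) - potential T A B x)) := by
  set Q := lyap T A (inputRho B Srho) Sini Sfin with hQd
  obtain ⟨c₀, hc₀⟩ := exists_gaussian_withDensity hSini hSref
  -- The bound `k < T` sits inside the existential so that one sequence of constants, `0` beyond the
  -- horizon, can be chosen.
  have hstep : ∀ k, ∃ c : ℝ, k < T → ∀ x : Vec n,
      step (A k) (B k) (policyRho T A B Srho Sini Sfin k) x =
      (step (A k) (B k) (Kernel.const (Vec n) (multivariateGaussian 0 (Srho k))) x).withDensity
        fun y => ENNReal.ofReal (Real.exp (c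
          - 1 / 2 * sqNorm ((pinv (B k))ᵀ * pinv (B k)) (y - (A k).toEuclideanLin x)
          + (1 / 2 * sqNorm (Q k)⁻¹ x - 1 / 2 * sqNorm (Q (k + 1))⁻¹ y))) := by
    intro k
    by_cases hk : k < T
    · have hsucc : Q (k + 1) = A k * Q k * (A k)ᵀ - B k * ((Srho k)⁻¹ + 1)⁻¹ * (B k)ᵀ := by
        rw [← inputRho_mul_transpose B (hSrho k hk)]; rfl
      obtain ⟨c, hc⟩ := exists_step_density (hA k hk) (hQ (k + 1) hk)
        (h.lyap_transpose (k + 1)) (hSrho k hk) hsucc rfl (hP k hk) (hB k hk)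
      exact ⟨c, fun _ => hc⟩
    · exact ⟨0, fun hk' => absurd hk' hk⟩
  choose c hc using hstep
  have hπ : ∀ k, IsMarkovKernel (policyRho T A B Srho Sini Sfin k) := fun k => by
    unfold policyRho; infer_instance
  have m1 := measurable_sqNorm Sini⁻¹
  have m2 := measurable_sqNorm Sref⁻¹
  have hψ : ∀ k, Measurable (Function.uncurry fun x y : Vec n => c k
      - 1 / 2 * sqNorm ((pinv (B k))ᵀ * pinv (B k)) (y - (A k).toEuclideanLin x)
      + (1 / 2 * sqNorm (Q k)⁻¹ x - 1 / 2 * sqNorm (Q (k + 1))⁻¹ y)) := fun k => by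
    have n1 := measurable_sqNorm ((pinv (B k))ᵀ * pinv (B k))
    have n2 := measurable_sqNorm (Q k)⁻¹
    have n3 := measurable_sqNorm (Q (k + 1))⁻¹
    have n4 := measurable_toEuclideanLin (A k)
    unfold Function.uncurry
    fun_prop
  have hden := processLaw_withDensity (A := A) (B := B) (μ₀ := multivariateGaussian 0 Sini)
    (ν₀ := multivariateGaussian μref Sref) (π := policyRho T A B Srho Sini Sfin)
    (η := fun k => Kernel.const (Vec n) (multivariateGaussian 0 (Srho k)))
    (by fun_prop) hψ (hc₀ 0 μref) T fun k hk => hc k hk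
  have hi : ∀ (M S : Mat n n) (μ : Vec n) (r : ℝ),
      Integrable (fun x => r * sqNorm M (x - μ)) (multivariateGaussian 0 S) :=
    fun M S μ r => (integrable_sqNorm_gaussian M S μ 0).const_mul r
  -- The function `a` collects the ratio of the initial laws, all normalizing constants and the head
  -- of the telescoping sum; `b` is its tail.
  refine ⟨fun x => c₀ - sqNorm Sini⁻¹ (x - 0) / 2 + sqNorm Sref⁻¹ (x - μref) / 2
      + (∑ k : Fin T, c k + 1 / 2 * sqNorm (Q 0)⁻¹ x),
    fun x => -(1 / 2 * sqNorm (Q T)⁻¹ x), ?_, ?_, ?_, ?_, ?_⟩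
  · have n2 := measurable_sqNorm (Q 0)⁻¹
    fun_prop
  · have n2 := measurable_sqNorm (Q T)⁻¹
    fun_prop
  · intro S
    have i1 := hi Sini⁻¹ S 0 (1 / 2)
    have i2 := hi Sref⁻¹ S μref (1 / 2)
    have i3 := hi (Q 0)⁻¹ S 0 (1 / 2)
    refine ((((integrable_const c₀).sub i1).add i2).add
      ((integrable_const (∑ k : Fin T, c k)).add i3)).congr (Filter.Eventually.of_forall fun x => ?_)
    simp only [Pi.add_apply, Pi.sub_apply, sub_zero]
    ring
  · intro S
    have i3 := (hi (Q T)⁻¹ S 0 (1 / 2)).neg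
    simpa using i3
  · rw [controlledLaw, referenceLaw, hden]
    congr 1
    funext x
    congr 2
    have ht := sum_castSucc_sub_succ fun i : Fin (T + 1) => 1 / 2 * sqNorm (Q i)⁻¹ (x i)
    simp only [Fin.val_castSucc, Fin.val_succ, Fin.val_zero, Fin.val_last] at ht
    rw [Finset.sum_add_distrib, Finset.sum_sub_distrib, ht, potential]
    ring

end MIBridge

/-! ### Feasibility, optimality and uniqueness -/

theorem theorem3 {n m : ℕ} (T : ℕ) (hT : 1 ≤ T)
    (A : ℕ → Mat n n) (B : ℕ → Mat n m)
    -- initial and terminal covariances, reference initial law, and the fixed prior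
    (Sini Sfin : Mat n n) (hSini : Sini.PosDef) (hSfin : Sfin.PosDef)
    (μref : Vec n) (Sref : Mat n n) (hSref : Sref.PosDef)
    (Srho : ℕ → Mat m m) (hSrho : ∀ k < T, (Srho k).PosDef)
    -- invertible state matrices and the Gramian condition for the input matrices `B_k^ρ`
    (hA : ∀ k < T, IsUnit (A k))
    (hGr : ∃ kr, 1 ≤ kr ∧ kr ≤ T ∧
      (∀ k, kr ≤ k → k ≤ T → IsUnit (Gr A (inputRho B Srho) k 0)) ∧
      (∀ k, k ≤ kr - 1 → IsUnit (Gr A (inputRho B Srho) T k)))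
    (hFminus : IsUnit (Fminus T A (inputRho B Srho) Sini Sfin))
    (hFplus : IsUnit (Fplus T A (inputRho B Srho) Sini Sfin))
    -- full column rank
    (hB : ∀ k < T, (B k).rank = m) :
    -- the policy `π^ρ` is well defined
    (∀ k ≤ T, IsUnit (lyap T A (inputRho B Srho) Sini Sfin k)) ∧
    (∀ k < T, (precision T A B Srho Sini Sfin k).PosDef) ∧
    -- its state process is feasible with a finite cost, and is the unique minimizer
    controlledLaw T A B Sini (policyRho T A B Srho Sini Sfin) ∈ couplings T Sini Sfin ∧
    objective T A B Srho μref Sref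
      (controlledLaw T A B Sini (policyRho T A B Srho Sini Sfin)) ≠ ⊤ ∧
    (∀ P ∈ couplings T Sini Sfin,
      objective T A B Srho μref Sref
        (controlledLaw T A B Sini (policyRho T A B Srho Sini Sfin)) ≤
      objective T A B Srho μref Sref P) ∧
    (∀ P ∈ couplings T Sini Sfin,
      objective T A B Srho μref Sref P ≤
        objective T A B Srho μref Sref
          (controlledLaw T A B Sini (policyRho T A B Srho Sini Sfin)) →
      P = controlledLaw T A B Sini (policyRho T A B Srho Sini Sfin)) := by 
  obtain ⟨kr, hkr1, hkr, h1, h2⟩ := hGr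
  -- The Gramian condition at `k = T` makes the full Gramian invertible.
  obtain ⟨W, hW⟩ := exists_lyapData hSini hSfin hA (h1 T hkr le_rfl) hFminus
  have hQ : ∀ k ≤ T, IsUnit (lyap T A (inputRho B Srho) Sini Sfin k) :=
    fun k hk => (hW.isUnit_lyap hA h1 h2 hk).2
  have hP : ∀ k < T, (precision T A B Srho Sini Sfin k).PosDef :=
    fun k hk => hW.precision_posDef hSrho hB hA h1 h2 hk
  have hπ : ∀ k, IsMarkovKernel (policyRho T A B Srho Sini Sfin k) := fun k => by
    unfold policyRho; infer_instance
  have hprob : IsProbabilityMeasure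
      (controlledLaw T A B Sini (policyRho T A B Srho Sini Sfin)) := by
    unfold controlledLaw; infer_instance
  have hprob' : IsProbabilityMeasure (referenceLaw T A B Srho μref Sref) := by
    unfold referenceLaw; infer_instance
  have hmem : controlledLaw T A B Sini (policyRho T A B Srho Sini Sfin)
      ∈ couplings T Sini Sfin := by
    refine ⟨hprob, processLaw_map_zero _ _ _ _ _, ?_⟩
    have := processLaw_map_last A B (gain T A B Srho Sini Sfin)
      (fun k => (precision T A B Srho Sini Sfin k)⁻¹) hSini.posSemidef T
      fun k hk => (hP k hk).inv.posSemidef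
    rw [hW.stateCov_eq hA hSrho hQ hP] at this
    exact this
  obtain ⟨a, b, ham, hbm, ha, hb, hden⟩ :=
    exists_controlledLaw_withDensity hSini μref hSref hSrho hW hA hB hQ hP
  -- The endpoint function is integrable with the same mean for every feasible `P`, since only its
  -- two marginals enter.
  have hend : ∀ P ∈ couplings T Sini Sfin,
      Integrable (fun x => a (x 0) + b (x (Fin.last T))) P ∧
      ∫ x, (a (x 0) + b (x (Fin.last T))) ∂P =
        ∫ x, a x ∂multivariateGaussian 0 Sini + ∫ x, b x ∂multivariateGaussian 0 Sfin := by
    rintro P ⟨_, hP0, hPT⟩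
    have i1 : Integrable (fun x => a (x 0)) P :=
      (hP0 ▸ ha Sini : Integrable a (P.map fun x => x 0)).comp_measurable (by fun_prop)
    have i2 : Integrable (fun x => b (x (Fin.last T))) P :=
      (hPT ▸ hb Sfin : Integrable b (P.map fun x => x (Fin.last T))).comp_measurable (by fun_prop)
    refine ⟨i1.add i2, ?_⟩
    have m1 : Measurable fun x : Fin (T + 1) → Vec n => x 0 := measurable_pi_apply _
    have m2 : Measurable fun x : Fin (T + 1) → Vec n => x (Fin.last T) := measurable_pi_apply _
    rw [integral_add i1 i2, ← hP0, ← hPT, integral_map m1.aemeasurable ham.aestronglyMeasurable,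
      integral_map m2.aemeasurable hbm.aestronglyMeasurable]
  have hfm : Measurable fun x : Fin (T + 1) → Vec n => a (x 0) + b (x (Fin.last T)) := by fun_prop
  have hVm := measurable_potential T A B
  have hV0 := potential_nonneg T A B
  have hbound : ∀ P ∈ couplings T Sini Sfin, InformationTheory.klDiv P
      (controlledLaw T A B Sini (policyRho T A B Srho Sini Sfin)) + objective T A B Srho μref Sref
        (controlledLaw T A B Sini (policyRho T A B Srho Sini Sfin)) ≤
      objective T A B Srho μref Sref P := by
    intro P hPc
    have := hPc.1
    exact klDiv_add_le_klDiv_add_potential hfm hVm hV0 hden (hend _ hmem).1 (hend P hPc).1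
      ((hend P hPc).2.trans (hend _ hmem).2.symm)
  have hfin : objective T A B Srho μref Sref
      (controlledLaw T A B Sini (policyRho T A B Srho Sini Sfin)) ≠ ⊤ := by
    rw [objective, (klDiv_add_potential_eq hfm hVm hV0 hden (hend _ hmem).1).1]
    exact ENNReal.ofReal_ne_top
  refine ⟨hQ, hP, hmem, hfin, fun P hPc => le_add_self.trans (hbound P hPc), fun P hPc hle => ?_⟩
  have := hPc.1
  have h3 := (hbound P hPc).trans hle
  have h4 : InformationTheory.klDiv P
      (controlledLaw T A B Sini (policyRho T A B Srho Sini Sfin)) = 0 := by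
    -- Finiteness of the minimum allows it to be cancelled, so a competitor of no greater cost has
    -- zero divergence from the closed loop.
    by_contra hne
    have h5 := ENNReal.lt_add_right hfin hne
    rw [add_comm] at h5
    exact absurd h3 (not_le.2 h5)
  exact InformationTheory.klDiv_eq_zero_iff.1 h4
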